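/- Let $N,d\in\mathbb N$, $m_1,\dots,m_N>0$, $\alpha\in(0,2)$, $T_1<T_2$. For $q=(q_1,\dots,q_N)\in\mathbb R^{dN}$ (with $q_i\in\mathbb R^d$) and $\mathbf I\subset\mathbf N=\{1,\dots,N\}$ put $$K_{\mathbf I}(\dot q)=\tfrac12\sum_{i\in\mathbf I}m_i|\dot q_i|^2,\qquad U_{\mathbf I}(q)=\sum_{i<j,\ i,j\in\mathbf I}\frac{m_im_j}{|q_i-q_j|^{\alpha}},\qquad \mathfrak U(q)=\sum_{i<j}\frac{m_im_j}{|q_i-q_j|^{2}},$$ $K=K_{\mathbf N}$, $U=U_{\mathbf N}$, with $U=\mathfrak U=+\infty$ on the collision set $\Delta=\{q:\ q_i=q_j\text{ for some }i\neq j\}$. Let $\mathcal X=\{q\in\mathbb R^{dN}:\sum_i m_iq_i=0\}$ and, for $\varepsilon\ge0$ and $q\in H^1([T_1,T_2],\mathcal X)$, let $$\mathcal A^{\varepsilon}(q)=\int_{T_1}^{T_2}\bigl(K(\dot q)+U(q)+\varepsilon\,\mathfrak U(q)\bigr)\,dt\in[0,\infty],\qquad \mathcal A=\mathcal A^0 .$$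 A critical point of $\mathcal A^\varepsilon$ is a path $q\in H^1([T_1,T_2],\mathcal X)$ with $q(t)\notin\Delta$ for all $t\in[T_1,T_2]$ such that $d\mathcal A^\varepsilon(q)[\varphi]=0$ for all $\varphi\in H^1([T_1,T_2],\mathcal X)$ with $\varphi(T_1)=\varphi(T_2)=0$. A path $q\in H^1([T_1,T_2],\mathcal X)$ with $\mathcal A(q)<\infty$ is a weak critical point of $\mathcal A$ if there are $\varepsilon_n>0$ with $\varepsilon_n\to0$ and $q^n\in H^1([T_1,T_2],\mathcal X)$ such that $\mathcal A^{\varepsilon_n}(q^n)<C$ for all $n$ and some finite constant $C$, each $q^n$ is a critical point of $\mathcal A^{\varepsilon_n}$, and $q^n\to q$ weakly in $H^1$ and uniformly on $[T_1,T_2]$. **Proposition.** Let $q\in H^1([T_1,T_2],\mathcal X)$ be a weak critical point of $\mathcal A$, and let $\Delta^{-1}(q)=\{t\in[T_1,T_2]: q(t)\in\Delta\}$. Then $q$ is a generalized solution of the $N$-body problem, that is: 1. $\Delta^{-1}(q)$ has Lebesgue measure $0$. 2. $q$ is $C^2$ on $[T_1,T_2]\setminus\Delta^{-1}(q)$ and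 satisfies there $$m_i\ddot q_i=-\alpha\sum_{j\ne i}m_im_j\frac{q_i-q_j}{|q_i-q_j|^{\alpha+2}},\qquad i\in\mathbf N$$ (derivatives at $T_1$, $T_2$ are one-sided). 3. The total energy $E(t)=K(\dot q(t))-U(q(t))$ takes the same value at all $t\in[T_1,T_2]\setminus\Delta^{-1}(q)$. 4. Let $\mathbf I\subset\mathbf N$, $T_1\le t_1<t_2\le T_2$, and let $E_{\mathbf I}(t)=K_{\mathbf I}(\dot q(t))-U_{\mathbf I}(q(t))$, which is defined for $t\notin\Delta^{-1}(q)$, hence almost everywhere. If $q_i(t)\ne q_j(t)$ for all $i\in\mathbf I$, $j\in\mathbf N\setminus\mathbf I$ and $t\in[t_1,t_2]$, then $E_{\mathbf I}\in H^1((t_1,t_2),\mathbb R)$, and $E_{\mathbf I}$ agrees on $[t_1,t_2]\setminus\Delta^{-1}(q)$ with its continuous representative. If this is only assumed for $t$ in the open interval $(t_1,t_2)$, then $E_{\mathbf I}\in H^1_{\mathrm{loc}}((t_1,t_2),\mathbb R)$, and $E_{\mathbf I}$ agrees on $(t_1,t_2)\setminus\Delta^{-1}(q)$ with a continuous function on $(t_1,t_2)$.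 -/

import Mathlib

open Set Filter Topology MeasureTheory
open scoped ENNReal

namespace NBody

noncomputable section

/-- A configuration of `N` point masses in `ℝ^d`. -/
abbrev Config (N d : ℕ) : Type := Fin N → EuclideanSpace ℝ (Fin d)

/-- `f` is the (absolutely continuous) representative of an element of the Sobolev space
`H¹([a, b], E)`: it is a primitive of a square-integrable function. Only the values of `f` on
`[a, b]` matter. -/
def IsH1 {E : Type*} [NormedAddCommGroup E] [NormedSpace ℝ E] [CompleteSpace E]
    (a b : ℝ) (f : ℝ → E) : Prop :=
  ∃ v : ℝ → E, MemLp v 2 (volume.restrict (Icc a b)) ∧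
    ∀ t ∈ Icc a b, f t = f a + ∫ s in a..t, v s

variable {N d : ℕ}

/-- The collision set `Δ`. -/
def IsCollision (x : Config N d) : Prop := ∃ i j : Fin N, i ≠ j ∧ x i = x j

/-- The space `𝒳` of configurations with center of mass at the origin. -/
def IsCentered (m : Fin N → ℝ) (x : Config N d) : Prop := ∑ i, m i • x i = 0

/-- `q ∈ H¹([T₁, T₂], 𝒳)`. -/
def IsCenteredH1 (m : Fin N → ℝ) (T₁ T₂ : ℝ) (q : ℝ → Config N d) : Prop :=
  IsH1 T₁ T₂ q ∧ ∀ t ∈ Icc T₁ T₂, IsCentered m (q t)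

/-- The velocity of the path `q : [T₁, T₂] → ℝ^{dN}` (one-sided at the two end-points). A Sobolev
path is differentiable almost everywhere, and this is then its weak derivative. -/
def velocity (T₁ T₂ : ℝ) (q : ℝ → Config N d) (t : ℝ) : Config N d :=
  fun i => derivWithin (fun s => q s i) (Icc T₁ T₂) t

/-- The kinetic energy `K_I` of the cluster `I`. -/
def kinetic (m : Fin N → ℝ) (I : Finset (Fin N)) (v : Config N d) : ℝ :=
  (1 / 2) * ∑ i ∈ I, m i * ‖v i‖ ^ 2

/-- The homogeneous potential `∑_{i < j in I} m_i m_j / |x_i - x_j| ^ β` of the cluster `I`, for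
collision-free `x`: the potential `U_I` for `β = α`, the strong force potential `𝔘_I` for
`β = 2`. -/
def potential (m : Fin N → ℝ) (β : ℝ) (I : Finset (Fin N)) (x : Config N d) : ℝ :=
  ∑ i ∈ I, ∑ j ∈ I with i < j, m i * m j / ‖x i - x j‖ ^ β

open Classical in
/-- The potential of all masses, with its value `+∞` at collisions. -/
def extPotential (m : Fin N → ℝ) (β : ℝ) (x : Config N d) : ℝ≥0∞ :=
  if IsCollision x then ⊤ else ENNReal.ofReal (potential m β Finset.univ x)

/-- The action `𝒜^ε(q; T₁, T₂) = ∫ K(q̇) + U(q) + ε 𝔘(q) dt`, with values in `[0, ∞]`. For `ε = 0`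
it is the action `𝒜` of the `N`-body problem with potential exponent `α`. -/
def action (m : Fin N → ℝ) (α ε T₁ T₂ : ℝ) (q : ℝ → Config N d) : ℝ≥0∞ :=
  ∫⁻ t in Icc T₁ T₂,
    (ENNReal.ofReal (kinetic m Finset.univ (velocity T₁ T₂ q t)) + extPotential m α (q t)
      + ENNReal.ofReal ε * extPotential m 2 (q t))

/-- `q` is a critical point of `𝒜^ε`: it is a collision-free path in `H¹([T₁, T₂], 𝒳)`, and the
differential of `𝒜^ε` at `q` vanishes on all variations in `H¹([T₁, T₂], 𝒳)` with fixed
end-points. (`𝒜^ε` is finite and `C²` near a collision-free path, so that its differential is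
given by its directional derivatives.) -/
def IsCriticalPoint (m : Fin N → ℝ) (α ε T₁ T₂ : ℝ) (q : ℝ → Config N d) : Prop :=
  IsCenteredH1 m T₁ T₂ q ∧
  (∀ t ∈ Icc T₁ T₂, ¬ IsCollision (q t)) ∧
  ∀ φ : ℝ → Config N d, IsCenteredH1 m T₁ T₂ φ → φ T₁ = 0 → φ T₂ = 0 →
    HasDerivAt (fun s : ℝ => (action m α ε T₁ T₂ (q + s • φ)).toReal) 0 0

/-- The inner product of `H¹([T₁, T₂], ℝ^{dN})`. -/
def h1Inner (T₁ T₂ : ℝ) (q φ : ℝ → Config N d) : ℝ :=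
  ∫ t in T₁..T₂, ∑ i, (inner ℝ (q t i) (φ t i)
    + inner ℝ (velocity T₁ T₂ q t i) (velocity T₁ T₂ φ t i))

/-- `q` is a weak critical point of `𝒜`. -/
def IsWeakCriticalPoint (m : Fin N → ℝ) (α T₁ T₂ : ℝ) (q : ℝ → Config N d) : Prop :=
  IsCenteredH1 m T₁ T₂ q ∧
  action m α 0 T₁ T₂ q < ⊤ ∧
  ∃ (ε : ℕ → ℝ) (p : ℕ → ℝ → Config N d),
    (∀ n, 0 < ε n) ∧ Tendsto ε atTop (𝓝 0) ∧
    (∀ n, IsCenteredH1 m T₁ T₂ (p n)) ∧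
    (∃ C : ℝ, ∀ n, action m α (ε n) T₁ T₂ (p n) < ENNReal.ofReal C) ∧
    (∀ n, IsCriticalPoint m α (ε n) T₁ T₂ (p n)) ∧
    (∀ φ : ℝ → Config N d, IsCenteredH1 m T₁ T₂ φ →
      Tendsto (fun n => h1Inner T₁ T₂ (p n) φ) atTop (𝓝 (h1Inner T₁ T₂ q φ))) ∧
    TendstoUniformlyOn p q atTop (Icc T₁ T₂)

/-- The set `Δ⁻¹(q)` of collision moments. -/
def collisionTimes (T₁ T₂ : ℝ) (q : ℝ → Config N d) : Set ℝ :=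
  {t | t ∈ Icc T₁ T₂ ∧ IsCollision (q t)}

/-- The energy `E_I(t) = K_I(q̇(t)) - U_I(q(t))` of the cluster `I`, at a moment `t` without
collision. -/
def clusterEnergy (m : Fin N → ℝ) (α T₁ T₂ : ℝ) (q : ℝ → Config N d) (I : Finset (Fin N))
    (t : ℝ) : ℝ :=
  kinetic m I (velocity T₁ T₂ q t) - potential m α I (q t)

/-- At the moment `t` no mass of the cluster `I` collides with a mass outside `I`. -/
def NoOutsideCollision (q : ℝ → Config N d) (I : Finset (Fin N)) (t : ℝ) : Prop :=
  ∀ i ∈ I, ∀ j ∉ I, q t i ≠ q t j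

/-- `q` is a generalized solution of the `N`-body problem on `[T₁, T₂]`. -/
structure IsGeneralizedSolution (m : Fin N → ℝ) (α T₁ T₂ : ℝ) (q : ℝ → Config N d) : Prop where
  /-- `q ∈ H¹([T₁, T₂], 𝒳)`. -/
  centeredH1 : IsCenteredH1 m T₁ T₂ q
  /-- The set of collision moments has measure zero. -/
  measure_zero : volume (collisionTimes T₁ T₂ q) = 0
  /-- `q` is of class `C²` off the collision moments. -/
  contDiffOn : ContDiffOn ℝ 2 q (Icc T₁ T₂ \ collisionTimes T₁ T₂ q)
  /-- `q` satisfies the equations of motion off the collision moments. -/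
  equation : ∀ t ∈ Icc T₁ T₂ \ collisionTimes T₁ T₂ q, ∀ i : Fin N,
    m i • iteratedDerivWithin 2 (fun s => q s i) (Icc T₁ T₂) t =
      -α • ∑ j ∈ Finset.univ.erase i,
        (m i * m j / ‖q t i - q t j‖ ^ (α + 2)) • (q t i - q t j)
  /-- The total energy is constant off the collision moments. -/
  energy_const : ∃ E₀ : ℝ, ∀ t ∈ Icc T₁ T₂ \ collisionTimes T₁ T₂ q,
    clusterEnergy m α T₁ T₂ q Finset.univ t = E₀
  /-- If the cluster `I` does not collide with outside masses on `[t₁, t₂]`, then `E_I` is of class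
  `H¹` on `[t₁, t₂]`: off the collision moments it coincides with an `H¹` function. -/
  cluster_h1 : ∀ (I : Finset (Fin N)) (t₁ t₂ : ℝ), T₁ ≤ t₁ → t₁ < t₂ → t₂ ≤ T₂ →
    (∀ t ∈ Icc t₁ t₂, NoOutsideCollision q I t) →
    ∃ e : ℝ → ℝ, IsH1 t₁ t₂ e ∧
      ∀ t ∈ Icc t₁ t₂ \ collisionTimes T₁ T₂ q, clusterEnergy m α T₁ T₂ q I t = e t
  /-- If this holds on the open interval `(t₁, t₂)`, then `E_I` is continuous and locally of class
  `H¹` there. -/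
  cluster_h1_loc : ∀ (I : Finset (Fin N)) (t₁ t₂ : ℝ), T₁ ≤ t₁ → t₁ < t₂ → t₂ ≤ T₂ →
    (∀ t ∈ Ioo t₁ t₂, NoOutsideCollision q I t) →
    ∃ e : ℝ → ℝ, ContinuousOn e (Ioo t₁ t₂) ∧
      (∀ a b : ℝ, t₁ < a → a < b → b < t₂ → IsH1 a b e) ∧
      ∀ t ∈ Ioo t₁ t₂ \ collisionTimes T₁ T₂ q, clusterEnergy m α T₁ T₂ q I t = e t

end

end NBody

/-! The perturbed paths `p n` avoid collisions altogether, so they obey classical identities on all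
of `[T₁, T₂]`; every assertion about `q` is a limit of such an identity, taken at moments when `q`
has no collision.

A critical point of the perturbed action is a classical solution of the perturbed Newton equations,
by a du Bois-Reymond argument within centered variations (`IsCriticalPoint.exists_momentum`,
`IsCriticalPoint.hasDerivWithinAt`). On a compact interval free of collisions of `q`, uniform
convergence keeps the masses of `p n` uniformly apart for large `n`. The accelerations are then
bounded and converge, hence so do the velocities, and `q` solves the unperturbed equations there
(`exists_tendsto_velocity`, `exists_local_solution`). The collision moments are null because the
potential is `+∞` on them and the action is finite.

Newton's equations for `q` alone say nothing about the energy on the two sides of a collision. For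
`p n`, however, the energy of a cluster `I` changes at exactly the power of the forces from outside
`I`; the internal forces, which may blow up as `n → ∞`, cancel. If `I` stays away from the other
masses, the outside forces are uniformly bounded, the action bounds the velocities in `L²`, and the
velocities converge almost everywhere, so the powers converge in `L¹`. In the limit
`clusterEnergy_sub` exhibits the cluster energy as a primitive of an `L²` function, across internal
collisions. For the cluster of all masses there is no outside force and the energy is constant. -/

namespace NBody

/-! ### Pair forces, the gradient of the potential, and separation of masses. -/

section PairForce

variable {N d : ℕ}

/-- The force that the `j`-th mass exerts on the `i`-th one through the pair potential
`m i * m j / r ^ β`. -/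
noncomputable def pairForce (m : Fin N → ℝ) (β : ℝ) (x : Config N d) (i j : Fin N) :
    EuclideanSpace ℝ (Fin d) :=
  (-β * (m i * m j / ‖x i - x j‖ ^ (β + 2))) • (x i - x j)

/-- The pair force of the perturbed potential `U + ε 𝔘`. -/
noncomputable def perturbedForce (m : Fin N → ℝ) (α ε : ℝ) (x : Config N d) (i j : Fin N) :
    EuclideanSpace ℝ (Fin d) :=
  pairForce m α x i j + ε • pairForce m 2 x i j

/-- The perturbed potential `U_I + ε 𝔘_I` of the cluster `I`. -/
noncomputable def perturbedPotential (m : Fin N → ℝ) (α ε : ℝ) (I : Finset (Fin N))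
    (x : Config N d) : ℝ :=
  potential m α I x + ε * potential m 2 I x

/-- Passes between unordered pairs, over which potentials are summed, and ordered pairs, over which
forces are summed. The general target serves both vector forces and their scalar powers. -/
lemma sum_lt_add_swap {M : Type*} [AddCommMonoid M] (I : Finset (Fin N)) (a : Fin N → Fin N → M)
    (ha : ∀ i, a i i = 0) :
    ∑ i ∈ I, ∑ j ∈ I with i < j, (a i j + a j i) = ∑ i ∈ I, ∑ j ∈ I, a i j := by
  have h : ∀ i j, a i j = (if i < j then a i j else 0) + (if j < i then a i j else 0) := by
    intro i j
    rcases lt_trichotomy i j with h | h | h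
    · simp [h, h.not_gt]
    · simp [h, ha]
    · simp [h, h.not_gt]
  calc ∑ i ∈ I, ∑ j ∈ I with i < j, (a i j + a j i)
      = ∑ i ∈ I, ∑ j ∈ I, (if i < j then a i j else 0)
        + ∑ i ∈ I, ∑ j ∈ I, (if i < j then a j i else 0) := by
        simp only [Finset.sum_add_distrib, Finset.sum_filter]
    _ = ∑ i ∈ I, ∑ j ∈ I, a i j := by
        rw [Finset.sum_comm (f := fun i j => if i < j then a j i else 0)]
        simp only [← Finset.sum_add_distrib, ← h]

@[simp] lemma pairForce_self (m : Fin N → ℝ) (β : ℝ) (x : Config N d) (i : Fin N) :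
    pairForce m β x i i = 0 := by simp [pairForce]

lemma pairForce_swap (m : Fin N → ℝ) (β : ℝ) (x : Config N d) (i j : Fin N) :
    pairForce m β x j i = -pairForce m β x i j := by
  rw [pairForce, pairForce, norm_sub_rev, mul_comm (m j), ← smul_neg, neg_sub]

@[simp] lemma perturbedForce_self (m : Fin N → ℝ) (α ε : ℝ) (x : Config N d) (i : Fin N) :
    perturbedForce m α ε x i i = 0 := by simp [perturbedForce]

lemma perturbedForce_swap (m : Fin N → ℝ) (α ε : ℝ) (x : Config N d) (i j : Fin N) :
    perturbedForce m α ε x j i = -perturbedForce m α ε x i j := by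
  simp only [perturbedForce, pairForce_swap m _ x i j]
  module

/-- Action equals reaction. This is what keeps the test variation for the Euler-Lagrange equations
centered. -/
lemma sum_perturbedForce (m : Fin N → ℝ) (α ε : ℝ) (x : Config N d) :
    ∑ i, ∑ j, perturbedForce m α ε x i j = 0 := by
  rw [← sum_lt_add_swap _ _ (perturbedForce_self m α ε x)]
  refine Finset.sum_eq_zero fun i _ => Finset.sum_eq_zero fun j _ => ?_
  rw [perturbedForce_swap m α ε x i j, add_neg_cancel]

/-- The function is a real power of `‖y‖ ^ 2`, which is differentiable along with `y` and nonzero at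
`t`. -/
lemma hasDerivWithinAt_div_norm_rpow {E : Type*} [NormedAddCommGroup E] [InnerProductSpace ℝ E]
    {y : ℝ → E} {y' : E} {s : Set ℝ} {t : ℝ} (hy : HasDerivWithinAt y y' s t) (h0 : y t ≠ 0)
    (c β : ℝ) :
    HasDerivWithinAt (fun τ => c / ‖y τ‖ ^ β)
      (inner ℝ ((-β * (c / ‖y t‖ ^ (β + 2))) • y t) y') s t := by
  have key : ∀ z : E, ∀ γ : ℝ, (‖z‖ ^ 2) ^ (-γ / 2) = (‖z‖ ^ γ)⁻¹ := by
    intro z γ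
    rw [← Real.rpow_natCast, ← Real.rpow_mul (norm_nonneg _), ← Real.rpow_neg (norm_nonneg _)]
    congr 1
    push_cast
    ring
  have hne : ‖y t‖ ^ 2 ≠ 0 := by positivity
  have h1 := (hy.norm_sq.rpow_const (p := -β / 2) (Or.inl hne)).const_mul c
  have e : -β / 2 - 1 = -(β + 2) / 2 := by ring
  simp only [e, key] at h1
  simp only [div_eq_mul_inv c]
  refine h1.congr_deriv ?_
  rw [real_inner_smul_left]
  ring

lemma hasDerivWithinAt_potential (m : Fin N → ℝ) (β : ℝ) (I : Finset (Fin N))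
    {x : ℝ → Config N d} {x' : Config N d} {s : Set ℝ} {t : ℝ}
    (hx : ∀ i, HasDerivWithinAt (fun τ => x τ i) (x' i) s t) (hc : ¬ IsCollision (x t)) :
    HasDerivWithinAt (fun τ => potential m β I (x τ))
      (∑ i ∈ I, ∑ j ∈ I, inner ℝ (pairForce m β (x t) i j) (x' i)) s t := by
  rw [← sum_lt_add_swap I (fun i j => inner ℝ (pairForce m β (x t) i j) (x' i)) (by simp)]
  unfold potential
  refine HasDerivWithinAt.fun_sum fun i _ => HasDerivWithinAt.fun_sum fun j hj => ?_
  have hij : x t i - x t j ≠ 0 := by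
    refine sub_ne_zero.2 fun h => hc ⟨i, j, ?_, h⟩
    exact (Finset.mem_filter.1 hj).2.ne
  refine (hasDerivWithinAt_div_norm_rpow ((hx i).sub (hx j)) hij (m i * m j) β).congr_deriv ?_
  rw [pairForce_swap m β (x t) i j, inner_neg_left, ← sub_eq_add_neg, ← inner_sub_right]
  rfl

lemma hasDerivWithinAt_perturbedPotential (m : Fin N → ℝ) (α ε : ℝ) (I : Finset (Fin N))
    {x : ℝ → Config N d} {x' : Config N d} {s : Set ℝ} {t : ℝ}
    (hx : ∀ i, HasDerivWithinAt (fun τ => x τ i) (x' i) s t) (hc : ¬ IsCollision (x t)) :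
    HasDerivWithinAt (fun τ => perturbedPotential m α ε I (x τ))
      (∑ i ∈ I, ∑ j ∈ I, inner ℝ (perturbedForce m α ε (x t) i j) (x' i)) s t := by
  refine ((hasDerivWithinAt_potential m α I hx hc).add
    ((hasDerivWithinAt_potential m 2 I hx hc).const_mul ε)).congr_deriv ?_
  simp only [perturbedForce, inner_add_left, real_inner_smul_left, Finset.sum_add_distrib,
    Finset.mul_sum]

/-- The size of the force is `β m_i m_j / r ^ (β + 1)`, which decreases in the distance `r`. -/
lemma norm_pairForce_le {m : Fin N → ℝ} (hm : ∀ i, 0 < m i) {β : ℝ} (hβ : 0 < β) {δ : ℝ}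
    (hδ : 0 < δ) {x : Config N d} {i j : Fin N} (h : δ ≤ ‖x i - x j‖) :
    ‖pairForce m β x i j‖ ≤ β * (m i * m j / δ ^ (β + 1)) := by
  have hr : 0 < ‖x i - x j‖ := hδ.trans_le h
  have h1 : ‖x i - x j‖ ^ (β + 2) = ‖x i - x j‖ ^ (β + 1) * ‖x i - x j‖ := by
    rw [← Real.rpow_add_one hr.ne']
    ring_nf
  have hi := hm i
  have hj := hm j
  have h2 : ‖pairForce m β x i j‖ = β * (m i * m j / ‖x i - x j‖ ^ (β + 1)) := by
    rw [pairForce, norm_smul, norm_mul, norm_neg, Real.norm_of_nonneg hβ.le,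
      Real.norm_of_nonneg (by positivity), h1]
    field_simp
  rw [h2]
  gcongr

lemma continuousAt_pairForce (m : Fin N → ℝ) (β : ℝ) {x : Config N d} {i j : Fin N}
    (h : x i ≠ x j) : ContinuousAt (fun y : Config N d => pairForce m β y i j) x := by
  have h0 : ‖x i - x j‖ ≠ 0 := norm_ne_zero_iff.2 (sub_ne_zero.2 h)
  have hc : ContinuousAt (fun y : Config N d => y i - y j) x := by fun_prop
  refine ContinuousAt.smul (continuousAt_const.mul (continuousAt_const.div
    (hc.norm.rpow_const (Or.inl h0)) ?_)) hc
  have := norm_nonneg (x i - x j)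
  positivity

lemma continuousAt_potential (m : Fin N → ℝ) (β : ℝ) (I : Finset (Fin N)) {x : Config N d}
    (h : ¬ IsCollision x) : ContinuousAt (fun y : Config N d => potential m β I y) x := by
  unfold potential
  refine tendsto_finsetSum _ fun i _ => tendsto_finsetSum _ fun j hj => ?_
  have hij : x i ≠ x j := fun e => h ⟨i, j, (Finset.mem_filter.1 hj).2.ne, e⟩
  have h0 : ‖x i - x j‖ ≠ 0 := norm_ne_zero_iff.2 (sub_ne_zero.2 hij)
  have hc : ContinuousAt (fun y : Config N d => y i - y j) x := by fun_prop
  refine continuousAt_const.div (hc.norm.rpow_const (Or.inl h0)) ?_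
  have := norm_nonneg (x i - x j)
  positivity

/-- The case `i = j` is admitted because the force sums run over all `j`; the diagonal term is
identically zero. -/
lemma continuousAt_perturbedForce (m : Fin N → ℝ) (α ε : ℝ) {x : Config N d} {i j : Fin N}
    (h : i = j ∨ x i ≠ x j) :
    ContinuousAt (fun y : Config N d => perturbedForce m α ε y i j) x := by
  rcases h with rfl | h
  · simpa using continuousAt_const
  · exact (continuousAt_pairForce m α h).add ((continuousAt_pairForce m 2 h).const_smul ε)

lemma potential_nonneg {m : Fin N → ℝ} (hm : ∀ i, 0 < m i) (β : ℝ) (I : Finset (Fin N))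
    (x : Config N d) : 0 ≤ potential m β I x :=
  Finset.sum_nonneg fun i _ => Finset.sum_nonneg fun j _ =>
    div_nonneg (mul_pos (hm i) (hm j)).le (by positivity)

lemma kinetic_nonneg {m : Fin N → ℝ} (hm : ∀ i, 0 < m i) (I : Finset (Fin N))
    (v : Config N d) : 0 ≤ kinetic m I v :=
  mul_nonneg (by norm_num) (Finset.sum_nonneg fun i _ => mul_nonneg (hm i).le (by positivity))

lemma isOpen_not_isCollision : IsOpen {x : Config N d | ¬ IsCollision x} := by
  have : {x : Config N d | ¬ IsCollision x} =
      ⋂ i, ⋂ j, ⋂ (_ : i ≠ j), {x : Config N d | x i ≠ x j} := by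
    ext x
    simp [IsCollision]
  rw [this]
  refine isOpen_iInter_of_finite fun i => isOpen_iInter_of_finite fun j =>
    isOpen_iInter_of_finite fun _ => isOpen_ne_fun (by fun_prop) (by fun_prop)

/-- Masses which do not meet on a compact set of moments keep a positive distance there. -/
lemma exists_separation {K : Set ℝ} (hK : IsCompact K) {q : ℝ → Config N d}
    (hq : ContinuousOn q K) (R : Fin N → Fin N → Prop)
    (h : ∀ t ∈ K, ∀ i j, R i j → q t i ≠ q t j) :
    ∃ δ > 0, ∀ t ∈ K, ∀ i j, R i j → δ ≤ ‖q t i - q t j‖ := by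
  have h1 : ∀ i j, ∃ δ > 0, ∀ t ∈ K, R i j → δ ≤ ‖q t i - q t j‖ := by
    intro i j
    by_cases hR : R i j
    · have hc : ContinuousOn (fun t => ‖q t i - q t j‖) K := by fun_prop
      obtain ⟨δ, hδ, hle⟩ := hK.exists_forall_le' hc (a := 0)
        fun t ht => norm_pos_iff.2 (sub_ne_zero.2 (h t ht i j hR))
      exact ⟨δ, hδ, fun t ht _ => hle t ht⟩
    · exact ⟨1, one_pos, fun _ _ h => absurd h hR⟩
  choose δ hδ hle using h1
  -- The element `1` keeps the finite set nonempty when there are no masses.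
  refine ⟨((Finset.univ ×ˢ Finset.univ : Finset (Fin N × Fin N)).image
    (fun p => δ p.1 p.2) ∪ {1}).min' (by simp), ?_, fun t ht i j hR =>
      le_trans (Finset.min'_le _ _ (by simp)) (hle i j t ht hR)⟩
  refine (Finset.lt_min'_iff _ _).2 fun y hy => ?_
  simp only [Finset.mem_union, Finset.mem_image, Finset.mem_singleton] at hy
  rcases hy with ⟨p, _, rfl⟩ | rfl
  · exact hδ _ _
  · exact one_pos

end PairForce

/-! ### Primitives of square-integrable functions and integration by parts. -/

section Sobolev

variable {E : Type*} [NormedAddCommGroup E]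

lemma intervalIntegrable_of_memLp_two {a b : ℝ} {v : ℝ → E}
    (hv : MemLp v 2 (volume.restrict (Icc a b))) {s t : ℝ} (hs : s ∈ Icc a b) (ht : t ∈ Icc a b) :
    IntervalIntegrable v volume s t := by
  have h : IntegrableOn v (Icc a b) := hv.integrable (by norm_num)
  exact (h.mono_set (uIcc_subset_Icc hs ht)).intervalIntegrable

variable [NormedSpace ℝ E]

lemma continuousOn_primitive_of_memLp_two {a b : ℝ} {v : ℝ → E}
    (hv : MemLp v 2 (volume.restrict (Icc a b))) {f : ℝ → E}
    (hf : ∀ t ∈ Icc a b, f t = f a + ∫ s in a..t, v s) : ContinuousOn f (Icc a b) := by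
  rcases lt_or_ge b a with hab | hab
  · simp [Icc_eq_empty hab.not_ge]
  have h : IntegrableOn v (uIcc a b) := by
    rw [uIcc_of_le hab]
    exact hv.integrable (by norm_num)
  have h1 := intervalIntegral.continuousOn_primitive_interval h
  rw [uIcc_of_le hab] at h1
  exact (continuousOn_const.add h1).congr hf

variable [CompleteSpace E]

lemma IsH1.continuousOn {a b : ℝ} {f : ℝ → E} (hf : IsH1 a b f) : ContinuousOn f (Icc a b) := by
  obtain ⟨v, hv, h⟩ := hf
  exact continuousOn_primitive_of_memLp_two hv h

/-- Lebesgue's differentiation theorem. The derivative is taken within `Icc a b` because `f` is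
prescribed only there. -/
lemma ae_hasDerivWithinAt_primitive {a b : ℝ} {v : ℝ → E}
    (hv : MemLp v 2 (volume.restrict (Icc a b))) {f : ℝ → E}
    (hf : ∀ t ∈ Icc a b, f t = f a + ∫ s in a..t, v s) :
    ∀ᵐ t ∂volume.restrict (Icc a b), HasDerivWithinAt f (v t) (Icc a b) t := by
  rcases lt_or_ge b a with hab | hab
  · simp [Icc_eq_empty hab.not_ge]
  have h := (intervalIntegrable_of_memLp_two hv (left_mem_Icc.2 hab)
    (right_mem_Icc.2 hab)).ae_hasDerivAt_integral
  rw [ae_restrict_iff' measurableSet_Icc]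
  filter_upwards [h] with t ht htI
  rw [uIcc_of_le hab] at ht
  exact ((ht htI a (left_mem_Icc.2 hab)).hasDerivWithinAt.const_add (f a)).congr hf (hf t htI)

lemma hasDerivWithinAt_primitive_of_continuousOn {a b : ℝ} {f : ℝ → E}
    (hf : ContinuousOn f (Icc a b)) {t : ℝ} (ht : t ∈ Icc a b) :
    HasDerivWithinAt (fun t => ∫ s in a..t, f s) (f t) (Icc a b) t := by
  have hab : a ≤ b := ht.1.trans ht.2
  -- This fact is what lets instance search find the one-sided filter at the end-points.
  have : Fact (t ∈ Icc a b) := ⟨ht⟩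
  refine intervalIntegral.integral_hasDerivWithinAt_right ?_ ?_ (hf t ht)
  · exact (hf.mono (uIcc_subset_Icc (left_mem_Icc.2 hab) ht)).intervalIntegrable
  · exact hf.stronglyMeasurableAtFilter_nhdsWithin measurableSet_Icc t

lemma sub_eq_integral_of_hasDerivWithinAt {a b : ℝ} {f f' : ℝ → E}
    (hf : ∀ t ∈ Icc a b, HasDerivWithinAt f (f' t) (Icc a b) t) (hf' : ContinuousOn f' (Icc a b))
    {s t : ℝ} (hs : s ∈ Icc a b) (ht : t ∈ Icc a b) : f t - f s = ∫ τ in s..t, f' τ := by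
  wlog hst : s ≤ t generalizing s t
  · rw [intervalIntegral.integral_symm, ← this ht hs (le_of_not_ge hst), neg_sub]
  have hsub : Icc s t ⊆ Icc a b := Icc_subset_Icc hs.1 ht.2
  rw [intervalIntegral.integral_eq_sub_of_hasDerivAt_of_le hst
    (fun x hx => (hf x (hsub hx)).continuousWithinAt.mono hsub)
    (fun x hx => (hf x (hsub (Ioo_subset_Icc_self hx))).hasDerivAt
      (Icc_mem_nhds (hs.1.trans_lt hx.1) (hx.2.trans_le ht.2)))]
  exact (hf'.mono (uIcc_subset_Icc hs ht)).intervalIntegrable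

/-- Integration by parts for two primitives in a Euclidean space. -/
lemma integral_inner_primitive_eq_zero {d : ℕ} {a b : ℝ} (hab : a ≤ b)
    {F w Φ φ : ℝ → EuclideanSpace ℝ (Fin d)} (hF : MemLp F 2 (volume.restrict (Icc a b)))
    (hw : MemLp w 2 (volume.restrict (Icc a b)))
    (hΦ : ∀ t ∈ Icc a b, Φ t = Φ a + ∫ s in a..t, F s)
    (hφ : ∀ t ∈ Icc a b, φ t = φ a + ∫ s in a..t, w s) (ha : φ a = 0) (hb : φ b = 0) :
    ∫ t in Icc a b, (inner ℝ (F t) (φ t) + inner ℝ (Φ t) (w t)) = 0 := by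
  have haI : a ∈ Icc a b := left_mem_Icc.2 hab
  have hbI : b ∈ Icc a b := right_mem_Icc.2 hab
  -- Integration by parts is done in each coordinate, for globally defined primitives that agree
  -- with the coordinates of `f` on `Icc a b`; their a.e. derivatives are the coordinates of `v`.
  have key : ∀ (v f : ℝ → EuclideanSpace ℝ (Fin d)), MemLp v 2 (volume.restrict (Icc a b)) →
      (∀ t ∈ Icc a b, f t = f a + ∫ s in a..t, v s) → ∀ k,
      AbsolutelyContinuousOnInterval (fun t => f a k + ∫ s in a..t, v s k) a b ∧
      (∀ t ∈ Icc a b, f t k = f a k + ∫ s in a..t, v s k) ∧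
      IntervalIntegrable (fun t => v t k) volume a b ∧
      ∀ᵐ t, t ∈ Icc a b → deriv (fun t => f a k + ∫ s in a..t, v s k) t = v t k := by
    intro v f hv hf k
    have hvk : MemLp (fun t => v t k) 2 (volume.restrict (Icc a b)) := by
      exact (EuclideanSpace.proj (𝕜 := ℝ) k).comp_memLp' hv
    have hi := intervalIntegrable_of_memLp_two hvk haI hbI
    refine ⟨?_, ?_, hi, ?_⟩
    · have h := hi.absolutelyContinuousOnInterval_intervalIntegral (c := a) (by simp)
      have h0 : AbsolutelyContinuousOnInterval (fun _ : ℝ => f a k) a b :=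
        (LipschitzWith.const (f a k)).lipschitzOnWith.absolutelyContinuousOnInterval
      exact h0.add h
    · intro t ht
      rw [hf t ht]
      have := (EuclideanSpace.proj (𝕜 := ℝ) k).intervalIntegral_comp_comm
        (intervalIntegrable_of_memLp_two hv haI ht)
      simp only [PiLp.add_apply]
      congr 1
      exact this.symm
    · filter_upwards [hi.ae_hasDerivAt_integral] with t ht htI
      rw [uIcc_of_le hab] at ht
      exact ((ht htI a haI).const_add (f a k)).deriv
  have hcoord : ∀ k, ∫ t in a..b, (F t k * φ t k + Φ t k * w t k) = 0 ∧
      IntervalIntegrable (fun t => F t k * φ t k + Φ t k * w t k) volume a b := by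
    intro k
    obtain ⟨hΦac, hΦe, hFi, hΦd⟩ := key F Φ hF hΦ k
    obtain ⟨hφac, hφe, hwi, hφd⟩ := key w φ hw hφ k
    have h := hΦac.integral_deriv_mul_eq_sub hφac
    have h2 : ∀ᵐ t, t ∈ uIoc a b →
        deriv (fun t => Φ a k + ∫ s in a..t, F s k) t * (φ a k + ∫ s in a..t, w s k)
          + (Φ a k + ∫ s in a..t, F s k) * deriv (fun t => φ a k + ∫ s in a..t, w s k) t
        = F t k * φ t k + Φ t k * w t k := by
      filter_upwards [hΦd, hφd] with t h1 h2 ht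
      have htI : t ∈ Icc a b := by
        rw [uIoc_of_le hab] at ht
        exact Ioc_subset_Icc_self ht
      rw [h1 htI, h2 htI, ← hΦe t htI, ← hφe t htI]
    have hΦc : ContinuousOn (fun t => Φ t k) (uIcc a b) := by
      rw [uIcc_of_le hab]
      have := continuousOn_primitive_of_memLp_two hF hΦ
      fun_prop
    have hφc : ContinuousOn (fun t => φ t k) (uIcc a b) := by
      rw [uIcc_of_le hab]
      have := continuousOn_primitive_of_memLp_two hw hφ
      fun_prop
    refine ⟨?_, (hFi.mul_continuousOn hφc).add (hwi.continuousOn_mul hΦc)⟩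
    rw [← intervalIntegral.integral_congr_ae h2, h, ← hφe b hbI, ← hφe a haI, ha, hb]
    simp
  rw [integral_Icc_eq_integral_Ioc, ← intervalIntegral.integral_of_le hab]
  have e : ∀ t, inner ℝ (F t) (φ t) + inner ℝ (Φ t) (w t)
      = ∑ k, (F t k * φ t k + Φ t k * w t k) := by
    intro t
    simp only [PiLp.inner_apply, ← Finset.sum_add_distrib]
    refine Finset.sum_congr rfl fun k _ => ?_
    simp [mul_comm]
  simp_rw [e]
  rw [intervalIntegral.integral_finsetSum fun k _ => (hcoord k).2]
  exact Finset.sum_eq_zero fun k _ => (hcoord k).1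

lemma memLp_two_apply {N d : ℕ} {μ : Measure ℝ} {v : ℝ → Config N d} (hv : MemLp v 2 μ)
    (i : Fin N) : MemLp (fun t => v t i) 2 μ :=
  (ContinuousLinearMap.proj (R := ℝ) (φ := fun _ : Fin N => EuclideanSpace ℝ (Fin d))
    i).comp_memLp' hv

end Sobolev

/-! ### The pointwise velocity as the weak derivative. -/

section Velocity

variable {N d : ℕ} {T₁ T₂ : ℝ}

lemma velocity_eq_of_hasDerivWithinAt (hT : T₁ < T₂) {q : ℝ → Config N d} {t : ℝ}
    (ht : t ∈ Icc T₁ T₂) {i : Fin N} {u : EuclideanSpace ℝ (Fin d)}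
    (h : HasDerivWithinAt (fun s => q s i) u (Icc T₁ T₂) t) : velocity T₁ T₂ q t i = u :=
  h.derivWithin (uniqueDiffOn_Icc hT t ht)

/-- Identifies the pointwise one-sided derivative with any density `v` witnessing `IsH1`, so that
later arguments can forget the witness. -/
lemma velocity_ae_eq (hT : T₁ < T₂) {q v : ℝ → Config N d}
    (hv : MemLp v 2 (volume.restrict (Icc T₁ T₂)))
    (hq : ∀ t ∈ Icc T₁ T₂, q t = q T₁ + ∫ s in T₁..t, v s) :
    velocity T₁ T₂ q =ᵐ[volume.restrict (Icc T₁ T₂)] v := by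
  filter_upwards [ae_hasDerivWithinAt_primitive hv hq, ae_restrict_mem measurableSet_Icc]
    with t h ht
  funext i
  exact velocity_eq_of_hasDerivWithinAt hT ht (hasDerivWithinAt_pi.1 h i)

lemma IsH1.memLp_velocity (hT : T₁ < T₂) {q : ℝ → Config N d} (hq : IsH1 T₁ T₂ q) :
    MemLp (velocity T₁ T₂ q) 2 (volume.restrict (Icc T₁ T₂)) := by
  obtain ⟨v, hv, h⟩ := hq
  exact hv.ae_eq (velocity_ae_eq hT hv h).symm

lemma IsH1.ae_hasDerivWithinAt (hT : T₁ < T₂) {q : ℝ → Config N d} (hq : IsH1 T₁ T₂ q) :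
    ∀ᵐ t ∂volume.restrict (Icc T₁ T₂), ∀ i,
      HasDerivWithinAt (fun s => q s i) (velocity T₁ T₂ q t i) (Icc T₁ T₂) t := by
  obtain ⟨v, hv, h⟩ := hq
  filter_upwards [velocity_ae_eq hT hv h, ae_hasDerivWithinAt_primitive hv h] with t h1 h2
  rw [h1]
  exact fun i => hasDerivWithinAt_pi.1 h2 i

lemma IsH1.eq_add_integral_velocity (hT : T₁ < T₂) {q : ℝ → Config N d} (hq : IsH1 T₁ T₂ q)
    {t : ℝ} (ht : t ∈ Icc T₁ T₂) : q t = q T₁ + ∫ s in T₁..t, velocity T₁ T₂ q s := by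
  obtain ⟨v, hv, h⟩ := hq
  rw [h t ht]
  congr 1
  refine intervalIntegral.integral_congr_ae ?_
  filter_upwards [(ae_restrict_iff' measurableSet_Icc).1 (velocity_ae_eq hT hv h)] with s hs hst
  rw [uIoc_of_le ht.1] at hst
  exact (hs ⟨hst.1.le, hst.2.trans ht.2⟩).symm

/-- Differentiate the linear constraint; derivatives within a nondegenerate interval are unique. -/
lemma IsCenteredH1.ae_isCentered_velocity (hT : T₁ < T₂) {m : Fin N → ℝ} {q : ℝ → Config N d}
    (hq : IsCenteredH1 m T₁ T₂ q) :
    ∀ᵐ t ∂volume.restrict (Icc T₁ T₂), IsCentered m (velocity T₁ T₂ q t) := by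
  filter_upwards [hq.1.ae_hasDerivWithinAt hT, ae_restrict_mem measurableSet_Icc] with t h ht
  have h1 : HasDerivWithinAt (fun s => ∑ i, m i • q s i) (∑ i, m i • velocity T₁ T₂ q t i)
      (Icc T₁ T₂) t := HasDerivWithinAt.fun_sum fun i _ => (h i).const_smul (m i)
  have h2 : HasDerivWithinAt (fun s => ∑ i, m i • q s i) 0 (Icc T₁ T₂) t :=
    (hasDerivWithinAt_const t _ (0 : EuclideanSpace ℝ (Fin d))).congr
      (fun s hs => hq.2 s hs) (hq.2 t ht)
  exact (uniqueDiffOn_Icc hT t ht).eq_deriv _ h1 h2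

lemma IsH1.add_smul {a b : ℝ} {q φ : ℝ → Config N d} (hq : IsH1 a b q) (hφ : IsH1 a b φ) (s : ℝ) :
    IsH1 a b (q + s • φ) := by
  obtain ⟨v, hv, h⟩ := hq
  obtain ⟨w, hw, h'⟩ := hφ
  refine ⟨v + s • w, hv.add (hw.const_smul s), fun t ht => ?_⟩
  have ha : a ∈ Icc a b := ⟨le_rfl, ht.1.trans ht.2⟩
  simp only [Pi.add_apply, Pi.smul_apply]
  rw [intervalIntegral.integral_add (g := fun τ => s • w τ)
    (intervalIntegrable_of_memLp_two hv ha ht)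
    (intervalIntegrable_of_memLp_two (hw.const_smul s) ha ht), intervalIntegral.integral_smul,
    h t ht, h' t ht]
  module

lemma velocity_add_smul_ae_eq (hT : T₁ < T₂) {q φ : ℝ → Config N d} (hq : IsH1 T₁ T₂ q)
    (hφ : IsH1 T₁ T₂ φ) (s : ℝ) :
    ∀ᵐ t ∂volume.restrict (Icc T₁ T₂),
      velocity T₁ T₂ (q + s • φ) t = velocity T₁ T₂ q t + s • velocity T₁ T₂ φ t := by
  filter_upwards [hq.ae_hasDerivWithinAt hT, hφ.ae_hasDerivWithinAt hT,
    ae_restrict_mem measurableSet_Icc] with t h1 h2 ht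
  funext i
  exact velocity_eq_of_hasDerivWithinAt hT ht ((h1 i).add ((h2 i).const_smul s))

end Velocity

/-! ### The first variation of the perturbed action. -/

section FirstVariation

variable {N d : ℕ} {T₁ T₂ : ℝ}

/-- The Lagrangian of the perturbed problem. -/
noncomputable def lagrangian (m : Fin N → ℝ) (α ε : ℝ) (x v : Config N d) : ℝ :=
  kinetic m Finset.univ v + perturbedPotential m α ε Finset.univ x

lemma lagrangian_nonneg {m : Fin N → ℝ} (hm : ∀ i, 0 < m i) {α ε : ℝ} (hε : 0 ≤ ε)
    (x v : Config N d) : 0 ≤ lagrangian m α ε x v :=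
  add_nonneg (kinetic_nonneg hm _ _) (add_nonneg (potential_nonneg hm _ _ _)
    (mul_nonneg hε (potential_nonneg hm _ _ _)))

lemma action_eq_lintegral {m : Fin N → ℝ} (hm : ∀ i, 0 < m i) (α : ℝ) {ε : ℝ} (hε : 0 ≤ ε)
    {q : ℝ → Config N d} (hc : ∀ t ∈ Icc T₁ T₂, ¬ IsCollision (q t)) :
    action m α ε T₁ T₂ q
      = ∫⁻ t in Icc T₁ T₂, ENNReal.ofReal (lagrangian m α ε (q t) (velocity T₁ T₂ q t)) := by
  refine setLIntegral_congr_fun measurableSet_Icc fun t ht => ?_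
  have h1 := kinetic_nonneg hm Finset.univ (velocity T₁ T₂ q t)
  have h2 := potential_nonneg hm α Finset.univ (q t)
  have h3 := potential_nonneg hm 2 Finset.univ (q t)
  simp only [extPotential, if_neg (hc t ht), lagrangian, perturbedPotential]
  rw [← ENNReal.ofReal_mul hε, add_assoc, ← ENNReal.ofReal_add h2 (by positivity),
    ← ENNReal.ofReal_add h1 (by positivity)]

lemma integrable_kinetic {μ : Measure ℝ} (m : Fin N → ℝ) (I : Finset (Fin N))
    {v : ℝ → Config N d} (hv : MemLp v 2 μ) : Integrable (fun t => kinetic m I (v t)) μ := by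
  unfold kinetic
  exact (integrable_finsetSum _ fun i _ =>
    ((memLp_two_apply hv i).integrable_norm_pow (by norm_num)).const_mul (m i)).const_mul _

lemma continuousOn_perturbedPotential (m : Fin N → ℝ) (α ε : ℝ) (I : Finset (Fin N)) {s : Set ℝ}
    {q : ℝ → Config N d} (hq : ContinuousOn q s) (hc : ∀ t ∈ s, ¬ IsCollision (q t)) :
    ContinuousOn (fun t => perturbedPotential m α ε I (q t)) s := fun t ht =>
  ContinuousAt.comp_continuousWithinAt (g := fun x => perturbedPotential m α ε I x)
    ((continuousAt_potential m α I (hc t ht)).add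
      ((continuousAt_potential m 2 I (hc t ht)).const_mul ε)) (hq t ht)

lemma continuousOn_perturbedForce (m : Fin N → ℝ) (α ε : ℝ) {s : Set ℝ} {i j : Fin N}
    {q : ℝ → Config N d} (hq : ContinuousOn q s) (hc : ∀ t ∈ s, i = j ∨ q t i ≠ q t j) :
    ContinuousOn (fun t => perturbedForce m α ε (q t) i j) s := fun t ht =>
  ContinuousAt.comp_continuousWithinAt (g := fun x => perturbedForce m α ε x i j)
    (continuousAt_perturbedForce m α ε (hc t ht)) (hq t ht)

lemma eq_or_ne_of_not_isCollision {x : Config N d} (h : ¬ IsCollision x) (i j : Fin N) :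
    i = j ∨ x i ≠ x j := by
  by_contra! hh
  exact h ⟨i, j, hh.1, hh.2⟩

lemma integrable_lagrangian (hT : T₁ < T₂) (m : Fin N → ℝ) (α ε : ℝ) {q : ℝ → Config N d}
    (hq : IsH1 T₁ T₂ q) (hc : ∀ t ∈ Icc T₁ T₂, ¬ IsCollision (q t)) :
    IntegrableOn (fun t => lagrangian m α ε (q t) (velocity T₁ T₂ q t)) (Icc T₁ T₂) :=
  (integrable_kinetic m _ (hq.memLp_velocity hT)).add
    (continuousOn_perturbedPotential m α ε _ hq.continuousOn hc).integrableOn_Icc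

lemma toReal_action (hT : T₁ < T₂) {m : Fin N → ℝ} (hm : ∀ i, 0 < m i) (α : ℝ) {ε : ℝ}
    (hε : 0 ≤ ε) {q : ℝ → Config N d} (hq : IsH1 T₁ T₂ q)
    (hc : ∀ t ∈ Icc T₁ T₂, ¬ IsCollision (q t)) :
    (action m α ε T₁ T₂ q).toReal
      = ∫ t in Icc T₁ T₂, lagrangian m α ε (q t) (velocity T₁ T₂ q t) := by
  rw [action_eq_lintegral hm α hε hc, integral_eq_lintegral_of_nonneg_ae
    (Eventually.of_forall fun t => lagrangian_nonneg hm hε _ _)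
    (integrable_lagrangian hT m α ε hq hc).aestronglyMeasurable]

lemma hasDerivAt_kinetic (m : Fin N → ℝ) (I : Finset (Fin N)) (v w : Config N d) (s : ℝ) :
    HasDerivAt (fun s : ℝ => kinetic m I (v + s • w))
      (∑ i ∈ I, m i * inner ℝ (v i + s • w i) (w i)) s := by
  unfold kinetic
  have h : ∀ i, HasDerivAt (fun s : ℝ => (v + s • w) i) (w i) s := fun i => by
    simpa using ((hasDerivAt_id s).smul_const (w i)).const_add (v i)
  refine ((HasDerivAt.fun_sum fun i (_ : i ∈ I) =>
    ((h i).norm_sq).const_mul (m i)).const_mul (1 / 2)).congr_deriv ?_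
  rw [Finset.mul_sum]
  refine Finset.sum_congr rfl fun i _ => ?_
  simp only [Pi.add_apply, Pi.smul_apply]
  ring

/-- The differential of the perturbed Lagrangian. -/
noncomputable def lagrangianDeriv (m : Fin N → ℝ) (α ε : ℝ) (x v y w : Config N d) : ℝ :=
  ∑ i, (m i * inner ℝ (v i) (w i) + ∑ j, inner ℝ (perturbedForce m α ε x i j) (y i))

lemma hasDerivAt_lagrangian (m : Fin N → ℝ) (α ε : ℝ) (x v y w : Config N d) (s : ℝ)
    (hc : ¬ IsCollision (x + s • y)) :
    HasDerivAt (fun s : ℝ => lagrangian m α ε (x + s • y) (v + s • w))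
      (lagrangianDeriv m α ε (x + s • y) (v + s • w) y w) s := by
  have h : ∀ i, HasDerivWithinAt (fun s : ℝ => (x + s • y) i) (y i) univ s := fun i => by
    refine HasDerivAt.hasDerivWithinAt ?_
    simpa using ((hasDerivAt_id s).smul_const (y i)).const_add (x i)
  have hp := hasDerivWithinAt_perturbedPotential m α ε Finset.univ h hc
  rw [hasDerivWithinAt_univ] at hp
  refine ((hasDerivAt_kinetic m _ v w s).add hp).congr_deriv ?_
  rw [lagrangianDeriv, Finset.sum_add_distrib]
  rfl

/-- A bound of the perturbed pair forces, if all distances are at least `δ`. -/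
noncomputable def forceBound (m : Fin N → ℝ) (α ε δ : ℝ) (i j : Fin N) : ℝ :=
  α * (m i * m j / δ ^ (α + 1)) + |ε| * (2 * (m i * m j / δ ^ ((2 : ℝ) + 1)))

lemma forceBound_nonneg {m : Fin N → ℝ} (hm : ∀ i, 0 < m i) {α : ℝ} (hα : 0 < α) (ε : ℝ)
    {δ : ℝ} (hδ : 0 < δ) (i j : Fin N) : 0 ≤ forceBound m α ε δ i j := by
  have := hm i
  have := hm j
  unfold forceBound
  positivity

lemma norm_perturbedForce_le {m : Fin N → ℝ} (hm : ∀ i, 0 < m i) {α : ℝ} (hα : 0 < α) (ε : ℝ)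
    {δ : ℝ} (hδ : 0 < δ) {x : Config N d} {i j : Fin N} (h : i = j ∨ δ ≤ ‖x i - x j‖) :
    ‖perturbedForce m α ε x i j‖ ≤ forceBound m α ε δ i j := by
  rcases h with rfl | h
  · simpa using forceBound_nonneg hm hα ε hδ i i
  · refine (norm_add_le _ _).trans (add_le_add (norm_pairForce_le hm hα hδ h) ?_)
    rw [norm_smul]
    exact mul_le_mul_of_nonneg_left (norm_pairForce_le hm two_pos hδ h) (abs_nonneg ε)

/-- The first variation of the action at a collision-free path. -/
lemma hasDerivAt_action (hT : T₁ < T₂) {m : Fin N → ℝ} (hm : ∀ i, 0 < m i) {α : ℝ} (hα : 0 < α)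
    {ε : ℝ} (hε : 0 ≤ ε) {q φ : ℝ → Config N d} (hq : IsH1 T₁ T₂ q)
    (hc : ∀ t ∈ Icc T₁ T₂, ¬ IsCollision (q t)) (hφ : IsH1 T₁ T₂ φ) :
    HasDerivAt (fun s : ℝ => (action m α ε T₁ T₂ (q + s • φ)).toReal)
      (∫ t in Icc T₁ T₂, lagrangianDeriv m α ε (q t) (velocity T₁ T₂ q t) (φ t)
        (velocity T₁ T₂ φ t)) 0 := by
  obtain ⟨δ, hδ, hsep⟩ := exists_separation isCompact_Icc hq.continuousOn (fun i j => i ≠ j)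
    (fun t ht i j hij h => hc t ht ⟨i, j, hij, h⟩)
  obtain ⟨B, hB⟩ := isCompact_Icc.exists_bound_of_continuousOn hφ.continuousOn
  have hB0 : 0 ≤ B := (norm_nonneg _).trans (hB T₁ (left_mem_Icc.2 hT.le))
  -- Two values of `φ` differ by at most `2 * B`, so a perturbation of size below `r` moves relative
  -- positions by at most `δ / 2` and distances stay at least `δ / 2`. The cap `1` serves the
  -- domination of the kinetic term, and `B + 1` keeps the denominator positive.
  set r : ℝ := min 1 (δ / (4 * (B + 1))) with hr
  have hr0 : 0 < r := by positivity
  have hfar : ∀ s ∈ Metric.ball (0 : ℝ) r, ∀ t ∈ Icc T₁ T₂, ∀ i j, i ≠ j →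
      δ / 2 ≤ ‖(q t + s • φ t) i - (q t + s • φ t) j‖ := by
    intro s hs t ht i j hij
    have h1 := hsep t ht i j hij
    have h2 : ‖φ t i - φ t j‖ ≤ 2 * B := by
      have := (norm_sub_le (φ t i) (φ t j)).trans
        (add_le_add (norm_le_pi_norm (φ t) i) (norm_le_pi_norm (φ t) j))
      linarith [hB t ht]
    have hs' : |s| < δ / (4 * (B + 1)) := by
      simpa using (mem_ball_zero_iff.1 hs).trans_le (min_le_right _ _)
    have h3 : ‖s • (φ t i - φ t j)‖ ≤ δ / 2 := by
      rw [norm_smul, Real.norm_eq_abs]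
      calc |s| * ‖φ t i - φ t j‖ ≤ δ / (4 * (B + 1)) * (2 * (B + 1)) := by
            gcongr
            linarith
        _ = δ / 2 := by field_simp; ring
    have h4 : (q t + s • φ t) i - (q t + s • φ t) j
        = (q t i - q t j) + s • (φ t i - φ t j) := by
      simp only [Pi.add_apply, Pi.smul_apply]
      module
    rw [h4]
    have := norm_sub_le_norm_add (q t i - q t j) (s • (φ t i - φ t j))
    linarith
  have hnc : ∀ s ∈ Metric.ball (0 : ℝ) r, ∀ t ∈ Icc T₁ T₂, ¬ IsCollision (q t + s • φ t) := by
    rintro s hs t ht ⟨i, j, hij, h⟩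
    have := hfar s hs t ht i j hij
    rw [h, sub_self, norm_zero] at this
    linarith
  set v := velocity T₁ T₂ q with hv
  set w := velocity T₁ T₂ φ with hw
  have hv2 : MemLp v 2 (volume.restrict (Icc T₁ T₂)) := hq.memLp_velocity hT
  have hw2 : MemLp w 2 (volume.restrict (Icc T₁ T₂)) := hφ.memLp_velocity hT
  have hae : ∀ s : ℝ, (fun t => lagrangian m α ε ((q + s • φ) t) (velocity T₁ T₂ (q + s • φ) t))
      =ᵐ[volume.restrict (Icc T₁ T₂)]
        fun t => lagrangian m α ε (q t + s • φ t) (v t + s • w t) := by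
    intro s
    filter_upwards [velocity_add_smul_ae_eq hT hq hφ s] with t ht
    rw [ht]
    rfl
  have hball : Metric.ball (0 : ℝ) r ∈ 𝓝 (0 : ℝ) := Metric.ball_mem_nhds _ hr0
  have hint : ∀ s ∈ Metric.ball (0 : ℝ) r, Integrable
      (fun t => lagrangian m α ε (q t + s • φ t) (v t + s • w t))
      (volume.restrict (Icc T₁ T₂)) := fun s hs =>
    (integrable_lagrangian hT m α ε (hq.add_smul hφ s) (hnc s hs)).congr (hae s)
  have hcongr : (fun s : ℝ => (action m α ε T₁ T₂ (q + s • φ)).toReal) =ᶠ[𝓝 0]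
      fun s => ∫ t in Icc T₁ T₂, lagrangian m α ε (q t + s • φ t) (v t + s • w t) := by
    filter_upwards [hball] with s hs
    rw [toReal_action hT hm α hε (hq.add_smul hφ s) (hnc s hs)]
    exact integral_congr_ae (hae s)
  have hmeas : AEStronglyMeasurable (fun t => lagrangianDeriv m α ε (q t + (0 : ℝ) • φ t)
      (v t + (0 : ℝ) • w t) (φ t) (w t)) (volume.restrict (Icc T₁ T₂)) := by
    simp only [zero_smul, add_zero, lagrangianDeriv]
    refine Finset.aestronglyMeasurable_fun_sum _ fun i _ => ?_
    refine (((memLp_two_apply hv2 i).1.inner (memLp_two_apply hw2 i).1).const_mul (m i)).add ?_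
    refine Finset.aestronglyMeasurable_fun_sum _ fun j _ => ?_
    have h1 := continuousOn_perturbedForce m α ε hq.continuousOn
      fun t ht => eq_or_ne_of_not_isCollision (hc t ht) i j
    have h2 := hφ.continuousOn
    exact ContinuousOn.aestronglyMeasurable (h1.inner (by fun_prop)) measurableSet_Icc
  -- Differentiation under the integral. For `|s| ≤ 1` the kinetic part is dominated by `‖v‖ ‖w‖ +
  -- ‖w‖ ^ 2`, integrable since both velocities are in `L²`; the force part is bounded by the
  -- separation `δ / 2`.
  have hmain := hasDerivAt_integral_of_dominated_loc_of_deriv_le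
    (F := fun s t => lagrangian m α ε (q t + s • φ t) (v t + s • w t))
    (F' := fun s t => lagrangianDeriv m α ε (q t + s • φ t) (v t + s • w t) (φ t) (w t))
    (bound := fun t => ∑ i, (m i * (‖v t i‖ * ‖w t i‖ + ‖w t i‖ ^ 2)
      + ∑ j, forceBound m α ε (δ / 2) i j * B))
    hball (by filter_upwards [hball] with s hs using (hint s hs).aestronglyMeasurable)
    (hint 0 (Metric.mem_ball_self hr0)) hmeas ?_ ?_ ?_
  · have h0 := hmain.2.congr_of_eventuallyEq hcongr
    simpa only [zero_smul, add_zero] using h0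
  · filter_upwards [ae_restrict_mem measurableSet_Icc] with t ht s hs
    refine (norm_sum_le _ _).trans (Finset.sum_le_sum fun i _ => (norm_add_le _ _).trans
      (add_le_add ?_ ((norm_sum_le _ _).trans (Finset.sum_le_sum fun j _ => ?_))))
    · rw [norm_mul, Real.norm_of_nonneg (hm i).le]
      refine mul_le_mul_of_nonneg_left ?_ (hm i).le
      refine (norm_inner_le_norm _ _).trans ?_
      have hs1 : ‖s‖ ≤ 1 := ((mem_ball_zero_iff.1 hs).trans_le (min_le_left _ _)).le
      have h1 : ‖(v t + s • w t) i‖ ≤ ‖v t i‖ + ‖w t i‖ := by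
        refine (norm_add_le _ _).trans (add_le_add le_rfl ?_)
        rw [Pi.smul_apply, norm_smul]
        exact mul_le_of_le_one_left (norm_nonneg _) hs1
      calc _ ≤ (‖v t i‖ + ‖w t i‖) * ‖w t i‖ := by gcongr
        _ = _ := by ring
    · refine (norm_inner_le_norm _ _).trans (mul_le_mul ?_ ?_ (norm_nonneg _)
        (forceBound_nonneg hm hα ε (by positivity) i j))
      · refine norm_perturbedForce_le hm hα ε (by positivity) ?_
        by_cases hij : i = j
        · exact Or.inl hij
        · exact Or.inr (hfar s hs t ht i j hij)
      · exact (norm_le_pi_norm (φ t) i).trans (hB t ht)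
  · refine integrable_finsetSum _ fun i _ => Integrable.add (Integrable.const_mul ?_ _)
      (integrable_finsetSum _ fun j _ => integrable_const _)
    refine Integrable.add ?_ ((memLp_two_apply hw2 i).integrable_norm_pow (by norm_num))
    exact (memLp_two_apply hv2 i).norm.integrable_mul (memLp_two_apply hw2 i).norm
  · filter_upwards [ae_restrict_mem measurableSet_Icc] with t ht s hs
    exact hasDerivAt_lagrangian m α ε _ _ _ _ s (hnc s hs t ht)

end FirstVariation

/-! ### The Euler-Lagrange equations by a du Bois-Reymond argument. -/

section EulerLagrange

variable {N d : ℕ} {T₁ T₂ : ℝ}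

lemma memLp_config {μ : Measure ℝ} {v : ℝ → Config N d} (h : ∀ i, MemLp (fun t => v t i) 2 μ) :
    MemLp v 2 μ :=
  MemLp.of_eval h

lemma integral_apply {v : ℝ → Config N d} {a b : ℝ} (hv : IntervalIntegrable v volume a b)
    (i : Fin N) : (∫ s in a..b, v s) i = ∫ s in a..b, v s i :=
  ((ContinuousLinearMap.proj (R := ℝ) (φ := fun _ : Fin N => EuclideanSpace ℝ (Fin d))
    i).intervalIntegral_comp_comm hv).symm

/-- The momenta of a critical point are primitives of the forces, almost everywhere. -/
lemma IsCriticalPoint.exists_momentum (hT : T₁ < T₂) {m : Fin N → ℝ} (hm : ∀ i, 0 < m i) {α : ℝ}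
    (hα : 0 < α) {ε : ℝ} (hε : 0 ≤ ε) {p : ℝ → Config N d} (hp : IsCriticalPoint m α ε T₁ T₂ p) :
    ∃ c : Config N d, ∀ᵐ t ∂volume.restrict (Icc T₁ T₂), ∀ i,
      m i • velocity T₁ T₂ p t i
        = c i + ∫ s in T₁..t, ∑ j, perturbedForce m α ε (p s) i j := by
  obtain ⟨⟨hH, hcen⟩, hc, hcrit⟩ := hp
  have hT₁ : T₁ ∈ Icc T₁ T₂ := left_mem_Icc.2 hT.le
  have hT₂ : T₂ ∈ Icc T₁ T₂ := right_mem_Icc.2 hT.le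
  set v := velocity T₁ T₂ p with hv
  have hv2 : MemLp v 2 (volume.restrict (Icc T₁ T₂)) := hH.memLp_velocity hT
  set f : Fin N → ℝ → EuclideanSpace ℝ (Fin d) :=
    fun i t => ∑ j, perturbedForce m α ε (p t) i j with hf
  have hfc : ∀ i, ContinuousOn (f i) (Icc T₁ T₂) := fun i =>
    continuousOn_finsetSum _ fun j _ => continuousOn_perturbedForce m α ε hH.continuousOn
      fun t ht => eq_or_ne_of_not_isCollision (hc t ht) i j
  have hmem : ∀ h : ℝ → EuclideanSpace ℝ (Fin d), ContinuousOn h (Icc T₁ T₂) →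
      MemLp h 2 (volume.restrict (Icc T₁ T₂)) := fun h hh => by
    obtain ⟨C, hC⟩ := isCompact_Icc.exists_bound_of_continuousOn hh
    exact MemLp.of_bound (hh.aestronglyMeasurable measurableSet_Icc) C
      ((ae_restrict_iff' measurableSet_Icc).2 (Eventually.of_forall hC))
  set Φ : Fin N → ℝ → EuclideanSpace ℝ (Fin d) := fun i t => ∫ s in T₁..t, f i s with hΦ
  have hΦc : ∀ i, ContinuousOn (Φ i) (Icc T₁ T₂) := fun i t ht =>
    (hasDerivWithinAt_primitive_of_continuousOn (hfc i) ht).continuousWithinAt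
  -- Momentum minus accumulated impulse. The goal is that `g i` is constant almost everywhere; the
  -- only candidate is its mean `c i`.
  set g : Fin N → ℝ → EuclideanSpace ℝ (Fin d) := fun i t => m i • v t i - Φ i t with hg
  have hg2 : ∀ i, MemLp (g i) 2 (volume.restrict (Icc T₁ T₂)) := fun i =>
    ((memLp_two_apply hv2 i).const_smul (m i)).sub (hmem _ (hΦc i))
  have hgi : ∀ i, IntervalIntegrable (g i) volume T₁ T₂ := fun i =>
    intervalIntegrable_of_memLp_two (hg2 i) hT₁ hT₂
  set c : Config N d := fun i => (T₂ - T₁)⁻¹ • ∫ t in T₁..T₂, g i t with hcdef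
  -- The total momentum vanishes by centering and the total impulse by action and reaction, so `g`
  -- respects the constraint.
  have hgsum : ∀ᵐ t ∂volume.restrict (Icc T₁ T₂), ∑ i, g i t = 0 := by
    filter_upwards [IsCenteredH1.ae_isCentered_velocity hT ⟨hH, hcen⟩,
      ae_restrict_mem measurableSet_Icc] with t h1 ht
    simp only [hg, Finset.sum_sub_distrib]
    have h2 : ∑ i, Φ i t = 0 := by
      simp only [hΦ]
      rw [← intervalIntegral.integral_finsetSum fun i _ =>
        ((hfc i).mono (uIcc_subset_Icc hT₁ ht)).intervalIntegrable]
      simp [hf, sum_perturbedForce]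
    rw [h2, sub_zero]
    exact h1
  have hcsum : ∑ i, c i = 0 := by
    simp only [hcdef]
    rw [← Finset.smul_sum, ← intervalIntegral.integral_finsetSum fun i _ => hgi i,
      intervalIntegral.integral_of_le hT.le, ← integral_Icc_eq_integral_Ioc,
      integral_congr_ae hgsum]
    simp
  -- The velocity of the test variation. Its zero mean makes `φ` vanish at `T₂`; the factor `(m
  -- i)⁻¹` turns the centering condition into `∑ i, (g i t - c i) = 0`.
  set ψ : ℝ → Config N d := fun t i => (m i)⁻¹ • (g i t - c i) with hψ
  have hψ2 : MemLp ψ 2 (volume.restrict (Icc T₁ T₂)) := memLp_config fun i =>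
    ((hg2 i).sub (memLp_const (c i))).const_smul (m i)⁻¹
  set φ : ℝ → Config N d := fun t => ∫ s in T₁..t, ψ s with hφ
  have hφ₁ : φ T₁ = 0 := intervalIntegral.integral_same
  have hφe : ∀ t ∈ Icc T₁ T₂, φ t = φ T₁ + ∫ s in T₁..t, ψ s := fun t _ => by
    rw [hφ₁, zero_add]
  have hφi : ∀ t ∈ Icc T₁ T₂, ∀ i, φ t i = ∫ s in T₁..t, ψ s i := fun t ht i =>
    integral_apply (intervalIntegrable_of_memLp_two hψ2 hT₁ ht) i
  have hψint : ∀ i, ∫ t in T₁..T₂, ψ t i = 0 := by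
    intro i
    simp only [hψ, intervalIntegral.integral_smul]
    rw [intervalIntegral.integral_sub (hgi i) intervalIntegrable_const,
      intervalIntegral.integral_const, hcdef, smul_smul,
      mul_inv_cancel₀ (sub_pos.2 hT).ne', one_smul, sub_self, smul_zero]
  have hφ₂ : φ T₂ = 0 := by
    funext i
    rw [hφi T₂ hT₂ i, hψint i, Pi.zero_apply]
  have hφH : IsH1 T₁ T₂ φ := ⟨ψ, hψ2, hφe⟩
  have hφcen : IsCenteredH1 m T₁ T₂ φ := by
    refine ⟨hφH, fun t ht => ?_⟩
    have hi : ∀ i, IntervalIntegrable (fun s => m i • ψ s i) volume T₁ t := fun i =>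
      intervalIntegrable_of_memLp_two ((memLp_two_apply hψ2 i).const_smul (m i)) hT₁ ht
    have h1 : ∑ i, m i • φ t i = ∫ s in T₁..t, ∑ i, m i • ψ s i := by
      rw [intervalIntegral.integral_finsetSum fun i _ => hi i]
      refine Finset.sum_congr rfl fun i _ => ?_
      rw [hφi t ht i]
      exact (intervalIntegral.integral_smul (m i) fun s => ψ s i).symm
    rw [IsCentered, h1, intervalIntegral.integral_of_le ht.1]
    have h2 : ∀ᵐ s ∂volume.restrict (Ioc T₁ t), ∑ i, m i • ψ s i = 0 := by
      have hsub : Ioc T₁ t ⊆ Icc T₁ T₂ := fun s hs => ⟨hs.1.le, hs.2.trans ht.2⟩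
      filter_upwards [ae_restrict_of_ae_restrict_of_subset hsub hgsum] with s hs
      have h3 : ∀ i, m i • ψ s i = g i s - c i := fun i => by
        simp only [hψ, smul_smul, mul_inv_cancel₀ (hm i).ne', one_smul]
      simp only [h3, Finset.sum_sub_distrib, hs, hcsum, sub_zero]
    rw [integral_congr_ae h2, integral_zero]
  have hderiv := (hcrit φ hφcen hφ₁ hφ₂).unique (hasDerivAt_action hT hm hα hε hH hc hφH)
  have hparts : ∀ i, ∫ t in Icc T₁ T₂, (inner ℝ (f i t) (φ t i) + inner ℝ (Φ i t) (ψ t i)) = 0 :=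
    fun i => integral_inner_primitive_eq_zero hT.le (hmem _ (hfc i)) (memLp_two_apply hψ2 i)
      (fun t ht => by simp [hΦ]) (fun t ht => by rw [hφ₁, hφi t ht i]; simp)
      (by rw [hφ₁]; rfl) (by rw [hφ₂]; rfl)
  have hinner : ∀ a b : ℝ → EuclideanSpace ℝ (Fin d),
      MemLp a 2 (volume.restrict (Icc T₁ T₂)) → MemLp b 2 (volume.restrict (Icc T₁ T₂)) →
      IntegrableOn (fun t => inner ℝ (a t) (b t)) (Icc T₁ T₂) := fun a b ha hb =>
    (ha.norm.integrable_mul hb.norm).mono' (ha.1.inner hb.1)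
      (Eventually.of_forall fun t => norm_inner_le_norm _ _)
  have hpartsI : ∀ i, IntegrableOn (fun t => inner ℝ (f i t) (φ t i) + inner ℝ (Φ i t) (ψ t i))
      (Icc T₁ T₂) := fun i => by
    refine (hinner _ _ (hmem _ (hfc i)) (hmem _ ?_)).add
      (hinner _ _ (hmem _ (hΦc i)) (memLp_two_apply hψ2 i))
    have := hφH.continuousOn
    fun_prop
  have hcψ : ∀ i, ∫ t in Icc T₁ T₂, inner ℝ (c i) (ψ t i) = 0 := fun i => by
    rw [integral_inner ((memLp_two_apply hψ2 i).integrable (by norm_num)) (c i),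
      integral_Icc_eq_integral_Ioc, ← intervalIntegral.integral_of_le hT.le, hψint i,
      inner_zero_right]
  have hcψI : ∀ i, IntegrableOn (fun t => inner ℝ (c i) (ψ t i)) (Icc T₁ T₂) := fun i =>
    hinner _ _ (memLp_const _) (memLp_two_apply hψ2 i)
  have hsqI : ∀ i, IntegrableOn (fun t => (m i)⁻¹ * ‖g i t - c i‖ ^ 2) (Icc T₁ T₂) := fun i =>
    (((hg2 i).sub (memLp_const (c i))).integrable_norm_pow (by norm_num)).const_mul _
  -- Writing `m i • v t i = (g i t - c i) + Φ i t + c i`, the `Φ` terms cancel against the forces by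
  -- parts and the `c` terms vanish as `ψ` has zero mean. Only a weighted square norm is left of the
  -- first variation.
  have hkey : ∫ t in Icc T₁ T₂, ∑ i, (m i)⁻¹ * ‖g i t - c i‖ ^ 2 = 0 := by
    have h1 : (fun t => lagrangianDeriv m α ε (p t) (v t) (φ t) (velocity T₁ T₂ φ t))
        =ᵐ[volume.restrict (Icc T₁ T₂)] fun t => ∑ i, (m i)⁻¹ * ‖g i t - c i‖ ^ 2
          + (∑ i, (inner ℝ (f i t) (φ t i) + inner ℝ (Φ i t) (ψ t i))
          + ∑ i, inner ℝ (c i) (ψ t i)) := by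
      filter_upwards [velocity_ae_eq hT hψ2 hφe] with t ht
      rw [ht, lagrangianDeriv, ← Finset.sum_add_distrib, ← Finset.sum_add_distrib]
      refine Finset.sum_congr rfl fun i _ => ?_
      have h2 : m i * inner ℝ (v t i) (ψ t i)
          = (m i)⁻¹ * ‖g i t - c i‖ ^ 2 + inner ℝ (Φ i t) (ψ t i) + inner ℝ (c i) (ψ t i) := by
        have h3 : m i • v t i = (g i t - c i) + Φ i t + c i := by
          simp only [hg]
          abel
        rw [← real_inner_smul_left, h3, inner_add_left, inner_add_left]
        congr 2
        simp only [hψ]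
        rw [real_inner_smul_right, real_inner_self_eq_norm_sq]
      rw [h2, ← sum_inner]
      simp only [hf]
      ring
    have hS : IntegrableOn (fun t => ∑ i, (m i)⁻¹ * ‖g i t - c i‖ ^ 2) (Icc T₁ T₂) :=
      integrable_finsetSum _ fun i _ => hsqI i
    have hA : IntegrableOn (fun t => ∑ i, (inner ℝ (f i t) (φ t i) + inner ℝ (Φ i t) (ψ t i)))
      (Icc T₁ T₂) := integrable_finsetSum _ fun i _ => hpartsI i
    have hC : IntegrableOn (fun t => ∑ i, inner ℝ (c i) (ψ t i)) (Icc T₁ T₂) :=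
      integrable_finsetSum _ fun i _ => hcψI i
    have hAC : IntegrableOn (fun t => ∑ i, (inner ℝ (f i t) (φ t i) + inner ℝ (Φ i t) (ψ t i))
      + ∑ i, inner ℝ (c i) (ψ t i)) (Icc T₁ T₂) := hA.add hC
    rw [integral_congr_ae h1, integral_add hS hAC, integral_add hA hC,
      integral_finsetSum _ fun i _ => hpartsI i, integral_finsetSum _ fun i _ => hcψI i,
      Finset.sum_eq_zero fun i _ => hparts i, Finset.sum_eq_zero fun i _ => hcψ i] at hderiv
    simpa using hderiv.symm
  have hnn : ∀ t i, 0 ≤ (m i)⁻¹ * ‖g i t - c i‖ ^ 2 := fun t i =>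
    mul_nonneg (inv_nonneg.2 (hm i).le) (by positivity)
  refine ⟨c, ?_⟩
  filter_upwards [(integral_eq_zero_iff_of_nonneg (fun t => Finset.sum_nonneg fun i _ => hnn t i)
    (integrable_finsetSum _ fun i _ => hsqI i)).1 hkey] with t ht i
  have h1 := (Finset.sum_eq_zero_iff_of_nonneg fun i _ => hnn t i).1 ht i (Finset.mem_univ i)
  have h2 : g i t - c i = 0 := by
    simpa [(hm i).ne'] using h1
  have h3 : m i • v t i = (g i t - c i) + c i + Φ i t := by
    simp only [hg]
    abel
  rw [h3, h2, zero_add]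

/-- Critical points are classical solutions of the perturbed equations of motion. -/
lemma IsCriticalPoint.hasDerivWithinAt (hT : T₁ < T₂) {m : Fin N → ℝ} (hm : ∀ i, 0 < m i)
    {α : ℝ} (hα : 0 < α) {ε : ℝ} (hε : 0 ≤ ε) {p : ℝ → Config N d}
    (hp : IsCriticalPoint m α ε T₁ T₂ p) {t : ℝ} (ht : t ∈ Icc T₁ T₂) (i : Fin N) :
    HasDerivWithinAt (fun s => p s i) (velocity T₁ T₂ p t i) (Icc T₁ T₂) t ∧
    HasDerivWithinAt (fun s => velocity T₁ T₂ p s i)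
      ((m i)⁻¹ • ∑ j, perturbedForce m α ε (p t) i j) (Icc T₁ T₂) t := by
  obtain ⟨c, hc⟩ := hp.exists_momentum hT hm hα hε
  obtain ⟨⟨hH, -⟩, hnc, -⟩ := hp
  have hfc : ContinuousOn (fun t => ∑ j, perturbedForce m α ε (p t) i j) (Icc T₁ T₂) :=
    continuousOn_finsetSum _ fun j _ => continuousOn_perturbedForce m α ε hH.continuousOn
      fun t ht => eq_or_ne_of_not_isCollision (hnc t ht) i j
  -- The continuous representative of the velocity. Since `p` is also the primitive of `u`, its
  -- derivative is `u` at every moment, which upgrades the a.e. identity to a pointwise one.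
  set u : ℝ → EuclideanSpace ℝ (Fin d) := fun t =>
    (m i)⁻¹ • (c i + ∫ s in T₁..t, ∑ j, perturbedForce m α ε (p s) i j) with hu
  have hu' : ∀ t ∈ Icc T₁ T₂, HasDerivWithinAt u
      ((m i)⁻¹ • ∑ j, perturbedForce m α ε (p t) i j) (Icc T₁ T₂) t := fun t ht =>
    ((hasDerivWithinAt_primitive_of_continuousOn hfc ht).const_add (c i)).const_smul (m i)⁻¹
  have huc : ContinuousOn u (Icc T₁ T₂) := fun t ht => (hu' t ht).continuousWithinAt
  have hpi : ∀ t ∈ Icc T₁ T₂, p t i = p T₁ i + ∫ s in T₁..t, u s := by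
    intro t ht
    rw [hH.eq_add_integral_velocity hT ht, Pi.add_apply, integral_apply
      (intervalIntegrable_of_memLp_two (hH.memLp_velocity hT) (left_mem_Icc.2 hT.le) ht)]
    congr 1
    refine intervalIntegral.integral_congr_ae ?_
    filter_upwards [(ae_restrict_iff' measurableSet_Icc).1 hc] with s hs hst
    rw [uIoc_of_le ht.1] at hst
    simp only [hu]
    rw [← hs ⟨hst.1.le, hst.2.trans ht.2⟩ i, smul_smul, inv_mul_cancel₀ (hm i).ne', one_smul]
  have hpu : ∀ t ∈ Icc T₁ T₂, HasDerivWithinAt (fun s => p s i) (u t) (Icc T₁ T₂) t :=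
    fun t ht => ((hasDerivWithinAt_primitive_of_continuousOn huc ht).const_add (p T₁ i)).congr
      hpi (hpi t ht)
  have hvu : ∀ t ∈ Icc T₁ T₂, velocity T₁ T₂ p t i = u t := fun t ht =>
    velocity_eq_of_hasDerivWithinAt hT ht (hpu t ht)
  exact ⟨by rw [hvu t ht]; exact hpu t ht, (hu' t ht).congr hvu (hvu t ht)⟩

end EulerLagrange

/-! ### Convergence of velocities and the equations of motion off collisions. -/

section Limit

lemma tendsto_primitive_of_bounded {E : Type*} [NormedAddCommGroup E] [NormedSpace ℝ E]
    {a b B : ℝ} {A : ℕ → ℝ → E} {F : ℝ → E} (hA : ∀ n, ContinuousOn (A n) (Icc a b))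
    (hB : ∀ᶠ n in atTop, ∀ t ∈ Icc a b, ‖A n t‖ ≤ B)
    (hF : ∀ t ∈ Icc a b, Tendsto (fun n => A n t) atTop (𝓝 (F t))) {t : ℝ} (ht : t ∈ Icc a b) :
    Tendsto (fun n => ∫ s in a..t, A n s) atTop (𝓝 (∫ s in a..t, F s)) := by
  have hsub : uIoc a t ⊆ Icc a b := by
    rw [uIoc_of_le ht.1]
    exact fun s hs => ⟨hs.1.le, hs.2.trans ht.2⟩
  refine intervalIntegral.tendsto_integral_filter_of_dominated_convergence (fun _ => B) ?_ ?_
    intervalIntegrable_const ?_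
  · exact Eventually.of_forall fun n =>
      ((hA n).mono hsub).aestronglyMeasurable measurableSet_uIoc
  · filter_upwards [hB] with n hn
    exact Eventually.of_forall fun s hs => hn s (hsub hs)
  · exact Eventually.of_forall fun s hs => hF s (hsub hs)

/-- If the solutions of second order equations converge together with their accelerations, then
their velocities converge, and the limit solves the limit equation. -/
lemma exists_tendsto_velocity {E : Type*} [NormedAddCommGroup E] [NormedSpace ℝ E]
    [CompleteSpace E] {a b B : ℝ} (hab : a < b) {P V A : ℕ → ℝ → E} {Q F : ℝ → E}
    (hP : ∀ n, ∀ t ∈ Icc a b, HasDerivWithinAt (P n) (V n t) (Icc a b) t)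
    (hV : ∀ n, ∀ t ∈ Icc a b, HasDerivWithinAt (V n) (A n t) (Icc a b) t)
    (hA : ∀ n, ContinuousOn (A n) (Icc a b))
    (hB : ∀ᶠ n in atTop, ∀ t ∈ Icc a b, ‖A n t‖ ≤ B)
    (hAF : ∀ t ∈ Icc a b, Tendsto (fun n => A n t) atTop (𝓝 (F t)))
    (hF : ContinuousOn F (Icc a b))
    (hPQ : ∀ t ∈ Icc a b, Tendsto (fun n => P n t) atTop (𝓝 (Q t))) :
    ∃ u : ℝ → E, ∀ t ∈ Icc a b, Tendsto (fun n => V n t) atTop (𝓝 (u t)) ∧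
      HasDerivWithinAt Q (u t) (Icc a b) t ∧ HasDerivWithinAt u (F t) (Icc a b) t := by
  have haI : a ∈ Icc a b := left_mem_Icc.2 hab.le
  have hbI : b ∈ Icc a b := right_mem_Icc.2 hab.le
  have hSn' : ∀ n, ∀ t ∈ Icc a b, HasDerivWithinAt (fun t => ∫ s in a..t, A n s) (A n t)
      (Icc a b) t := fun n t ht => hasDerivWithinAt_primitive_of_continuousOn (hA n) ht
  have hS' : ∀ t ∈ Icc a b, HasDerivWithinAt (fun t => ∫ s in a..t, F s) (F t) (Icc a b) t :=
    fun t ht => hasDerivWithinAt_primitive_of_continuousOn hF ht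
  set S : ℕ → ℝ → E := fun n t => ∫ s in a..t, A n s with hSdef
  set S₀ : ℝ → E := fun t => ∫ s in a..t, F s with hS₀def
  have hSc : ∀ n, ContinuousOn (S n) (Icc a b) := fun n t ht => (hSn' n t ht).continuousWithinAt
  have hS₀c : ContinuousOn S₀ (Icc a b) := fun t ht => (hS' t ht).continuousWithinAt
  have hSlim : ∀ t ∈ Icc a b, Tendsto (fun n => S n t) atTop (𝓝 (S₀ t)) := fun t ht =>
    tendsto_primitive_of_bounded hA hB hAF ht
  have hSB : ∀ᶠ n in atTop, ∀ t ∈ Icc a b, ‖S n t‖ ≤ |B| * (b - a) := by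
    filter_upwards [hB] with n hn t ht
    refine (intervalIntegral.norm_integral_le_of_norm_le_const (C := |B|) fun s hs => ?_).trans ?_
    · rw [uIoc_of_le ht.1] at hs
      exact (hn s ⟨hs.1.le, hs.2.trans ht.2⟩).trans (le_abs_self B)
    · rw [abs_of_nonneg (sub_nonneg.2 ht.1)]
      gcongr
      exact ht.2
  have hVS : ∀ n, ∀ t ∈ Icc a b, V n t = V n a + S n t := fun n t ht => by
    simp only [hSdef]
    rw [← sub_eq_integral_of_hasDerivWithinAt (hV n) (hA n) haI ht, add_sub_cancel]
  -- Taylor's formula with integral remainder. At `t = b` it can be solved for the initial velocity,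
  -- which therefore converges because positions and accelerations do.
  have hPS : ∀ n, ∀ t ∈ Icc a b, P n t - P n a = (t - a) • V n a + ∫ s in a..t, S n s := by
    intro n t ht
    have hi : IntervalIntegrable (S n) volume a t :=
      ((hSc n).mono (uIcc_subset_Icc haI ht)).intervalIntegrable
    rw [sub_eq_integral_of_hasDerivWithinAt (hP n)
      (fun t ht => (hV n t ht).continuousWithinAt) haI ht, ← intervalIntegral.integral_const,
      ← intervalIntegral.integral_add intervalIntegrable_const hi]
    refine intervalIntegral.integral_congr fun s hs => hVS n s ?_
    rw [uIcc_of_le ht.1] at hs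
    exact ⟨hs.1, hs.2.trans ht.2⟩
  have hISlim : ∀ t ∈ Icc a b,
      Tendsto (fun n => ∫ s in a..t, S n s) atTop (𝓝 (∫ s in a..t, S₀ s)) := fun t ht =>
    tendsto_primitive_of_bounded hSc hSB hSlim ht
  set v₀ : E := (b - a)⁻¹ • (Q b - Q a - ∫ s in a..b, S₀ s) with hv₀
  have hv : Tendsto (fun n => V n a) atTop (𝓝 v₀) := by
    refine ((((hPQ b hbI).sub (hPQ a haI)).sub (hISlim b hbI)).const_smul (b - a)⁻¹).congr
      fun n => ?_
    rw [hPS n b hbI, add_sub_cancel_right, smul_smul, inv_mul_cancel₀ (sub_pos.2 hab).ne',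
      one_smul]
  have hu' : ∀ t ∈ Icc a b, HasDerivWithinAt (fun t => v₀ + S₀ t) (F t) (Icc a b) t :=
    fun t ht => (hS' t ht).const_add v₀
  have huc : ContinuousOn (fun t => v₀ + S₀ t) (Icc a b) := fun t ht =>
    (hu' t ht).continuousWithinAt
  have hQ : ∀ t ∈ Icc a b, Q t = Q a + ∫ s in a..t, (v₀ + S₀ s) := by
    intro t ht
    have hi : IntervalIntegrable S₀ volume a t :=
      (hS₀c.mono (uIcc_subset_Icc haI ht)).intervalIntegrable
    rw [intervalIntegral.integral_add intervalIntegrable_const hi,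
      intervalIntegral.integral_const, ← sub_eq_iff_eq_add']
    refine tendsto_nhds_unique ((hPQ t ht).sub (hPQ a haI)) ?_
    refine ((hv.const_smul (t - a)).add (hISlim t ht)).congr fun n => (hPS n t ht).symm
  refine ⟨fun t => v₀ + S₀ t, fun t ht => ⟨?_, ?_, hu' t ht⟩⟩
  · exact (hv.add (hSlim t ht)).congr fun n => (hVS n t ht).symm
  · exact ((hasDerivWithinAt_primitive_of_continuousOn huc ht).const_add (Q a)).congr hQ (hQ t ht)

variable {N d : ℕ} {T₁ T₂ : ℝ}

/-- If the limit has separation `δ` and each mass is moved by at most `δ / 4`, then `δ / 2`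
survives. The relation `R` is `i ≠ j` for the equations of motion, and "`i` inside, `j` outside the
cluster" for the energy. -/
lemma exists_uniform_separation {K : Set ℝ} (hK : IsCompact K) {p : ℕ → ℝ → Config N d}
    {q : ℝ → Config N d} (hq : ContinuousOn q K) (hpq : TendstoUniformlyOn p q atTop K)
    (R : Fin N → Fin N → Prop) (h : ∀ t ∈ K, ∀ i j, R i j → q t i ≠ q t j) :
    ∃ δ > 0, ∀ᶠ n in atTop, ∀ t ∈ K, ∀ i j, R i j → δ ≤ ‖p n t i - p n t j‖ := by
  obtain ⟨δ, hδ, hsep⟩ := exists_separation hK hq R h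
  refine ⟨δ / 2, by positivity, ?_⟩
  filter_upwards [Metric.tendstoUniformlyOn_iff.1 hpq (δ / 4) (by positivity)] with n hn t ht i j hR
  have h1 := hsep t ht i j hR
  have h2 : ∀ k, ‖q t k - p n t k‖ ≤ δ / 4 := fun k => by
    have := (dist_le_pi_dist (q t) (p n t) k).trans (hn t ht).le
    rwa [dist_eq_norm] at this
  have h3 : q t i - q t j = (p n t i - p n t j) + ((q t i - p n t i) - (q t j - p n t j)) := by
    abel
  rw [h3] at h1
  have h4 := norm_add_le (p n t i - p n t j) ((q t i - p n t i) - (q t j - p n t j))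
  have h5 := norm_sub_le (q t i - p n t i) (q t j - p n t j)
  linarith [h2 i, h2 j]

/-- Away from a collision the strong force stays bounded, so its coefficient `ε n` removes it in the
limit. -/
lemma tendsto_perturbedForce (m : Fin N → ℝ) (α : ℝ) {ε : ℕ → ℝ} (hε : Tendsto ε atTop (𝓝 0))
    {x : ℕ → Config N d} {y : Config N d} (hx : Tendsto x atTop (𝓝 y)) {i j : Fin N}
    (h : i = j ∨ y i ≠ y j) :
    Tendsto (fun n => perturbedForce m α (ε n) (x n) i j) atTop (𝓝 (pairForce m α y i j)) := by
  rcases h with rfl | h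
  · simp
  · have h1 := (continuousAt_pairForce m α h).tendsto.comp hx
    have h2 := hε.smul ((continuousAt_pairForce m 2 h).tendsto.comp hx)
    simpa [perturbedForce] using h1.add h2

lemma perturbedForce_zero (m : Fin N → ℝ) (α : ℝ) (x : Config N d) (i j : Fin N) :
    perturbedForce m α 0 x i j = pairForce m α x i j := by simp [perturbedForce]

lemma continuousOn_pairForce (m : Fin N → ℝ) (α : ℝ) {s : Set ℝ} {i j : Fin N}
    {q : ℝ → Config N d} (hq : ContinuousOn q s) (hc : ∀ t ∈ s, i = j ∨ q t i ≠ q t j) :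
    ContinuousOn (fun t => pairForce m α (q t) i j) s := by
  simpa only [perturbedForce_zero] using continuousOn_perturbedForce m α 0 hq hc

lemma forceBound_le_forceBound_one {m : Fin N → ℝ} (hm : ∀ i, 0 < m i) {α ε : ℝ} (hε : |ε| ≤ 1)
    {δ : ℝ} (hδ : 0 < δ) (i j : Fin N) : forceBound m α ε δ i j ≤ forceBound m α 1 δ i j := by
  have := hm i
  have := hm j
  unfold forceBound
  rw [abs_one]
  gcongr

lemma eventually_abs_le_one {ε : ℕ → ℝ} (hε : Tendsto ε atTop (𝓝 0)) :
    ∀ᶠ n in atTop, |ε n| ≤ 1 := by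
  filter_upwards [hε.eventually (Metric.closedBall_mem_nhds 0 one_pos)] with n hn
  simpa using hn

/-- A moment without collision lies in a compact interval without collisions. -/
lemma exists_Icc_not_isCollision (hT : T₁ < T₂) {q : ℝ → Config N d}
    (hq : ContinuousOn q (Icc T₁ T₂)) {t₀ : ℝ} (ht₀ : t₀ ∈ Icc T₁ T₂ \ collisionTimes T₁ T₂ q) :
    ∃ a b, a < b ∧ t₀ ∈ Icc a b ∧ Icc a b ⊆ Icc T₁ T₂ ∧ Icc a b ∈ 𝓝[Icc T₁ T₂] t₀ ∧
      ∀ t ∈ Icc a b, ¬ IsCollision (q t) := by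
  obtain ⟨ht, hc⟩ := ht₀
  have hc' : ¬ IsCollision (q t₀) := fun h => hc ⟨ht, h⟩
  obtain ⟨r, hr, hsub⟩ := Metric.mem_nhdsWithin_iff.1
    ((hq t₀ ht).eventually (isOpen_not_isCollision.mem_nhds hc'))
  -- Clipping at `T₁` and `T₂` includes the end-points; the radius `r / 2` keeps the closed interval
  -- inside the open ball.
  refine ⟨max T₁ (t₀ - r / 2), min T₂ (t₀ + r / 2), ?_, ?_, ?_, ?_, ?_⟩
  · rcases ht with ⟨h1, h2⟩
    refine max_lt (lt_min hT ?_) (lt_min ?_ ?_) <;> linarith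
  · exact ⟨max_le ht.1 (by linarith), le_min ht.2 (by linarith)⟩
  · exact Icc_subset_Icc (le_max_left _ _) (min_le_left _ _)
  · rw [← Icc_inter_Icc]
    exact inter_mem self_mem_nhdsWithin
      (mem_nhdsWithin_of_mem_nhds (Icc_mem_nhds (by linarith) (by linarith)))
  · intro t h
    refine hsub ⟨?_, (le_max_left _ _).trans h.1, h.2.trans (min_le_left _ _)⟩
    rw [Metric.mem_ball, Real.dist_eq, abs_lt]
    have h1 := (le_max_right _ _).trans h.1
    have h2 := h.2.trans (min_le_right _ _)
    constructor <;> linarith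

/-- The limit of critical points of the perturbed actions solves the equations of motion near
every moment without collision, where the velocities converge. -/
lemma exists_local_solution (hT : T₁ < T₂) {m : Fin N → ℝ} (hm : ∀ i, 0 < m i) {α : ℝ}
    (hα : 0 < α) {ε : ℕ → ℝ} (hε : ∀ n, 0 < ε n) (hε0 : Tendsto ε atTop (𝓝 0))
    {p : ℕ → ℝ → Config N d} (hp : ∀ n, IsCriticalPoint m α (ε n) T₁ T₂ (p n))
    {q : ℝ → Config N d} (hq : IsH1 T₁ T₂ q) (hpq : TendstoUniformlyOn p q atTop (Icc T₁ T₂))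
    {t₀ : ℝ} (ht₀ : t₀ ∈ Icc T₁ T₂ \ collisionTimes T₁ T₂ q) :
    ∃ a b, a < b ∧ t₀ ∈ Icc a b ∧ Icc a b ⊆ Icc T₁ T₂ ∧ Icc a b ∈ 𝓝[Icc T₁ T₂] t₀ ∧
      (∀ t ∈ Icc a b, ¬ IsCollision (q t)) ∧
      ∀ i, ∃ u : ℝ → EuclideanSpace ℝ (Fin d), ∀ t ∈ Icc a b,
        Tendsto (fun n => velocity T₁ T₂ (p n) t i) atTop (𝓝 (u t)) ∧
        HasDerivWithinAt (fun s => q s i) (u t) (Icc a b) t ∧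
        HasDerivWithinAt u ((m i)⁻¹ • ∑ j, pairForce m α (q t) i j) (Icc a b) t := by
  obtain ⟨a, b, hab, htI, hsub, hnhds, hnc⟩ :=
    exists_Icc_not_isCollision hT hq.continuousOn ht₀
  refine ⟨a, b, hab, htI, hsub, hnhds, hnc, fun i => ?_⟩
  have hqc := hq.continuousOn.mono hsub
  obtain ⟨δ, hδ, hsep⟩ := exists_uniform_separation isCompact_Icc hqc (hpq.mono hsub)
    (fun i j => i ≠ j) (fun t ht i j hij h => hnc t ht ⟨i, j, hij, h⟩)
  refine exists_tendsto_velocity (B := (m i)⁻¹ * ∑ j, forceBound m α 1 δ i j)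
    (P := fun n s => p n s i) (A := fun n t => (m i)⁻¹ • ∑ j, perturbedForce m α (ε n) (p n t) i j)
    hab
    (fun n t ht => (((hp n).hasDerivWithinAt hT hm hα (hε n).le (hsub ht) i).1).mono hsub)
    (fun n t ht => (((hp n).hasDerivWithinAt hT hm hα (hε n).le (hsub ht) i).2).mono hsub)
    (fun n => ?_) ?_ (fun t ht => ?_) ?_ (fun t ht => ?_)
  · exact (continuousOn_finsetSum _ fun j _ =>
      continuousOn_perturbedForce m α (ε n) ((hp n).1.1.continuousOn.mono hsub)
        fun t ht => eq_or_ne_of_not_isCollision ((hp n).2.1 t (hsub ht)) i j).const_smul (m i)⁻¹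
  · filter_upwards [hsep, eventually_abs_le_one hε0] with n hn hn1 t ht
    rw [norm_smul, Real.norm_of_nonneg (inv_nonneg.2 (hm i).le)]
    refine mul_le_mul_of_nonneg_left ((norm_sum_le _ _).trans (Finset.sum_le_sum fun j _ => ?_))
      (inv_nonneg.2 (hm i).le)
    refine (norm_perturbedForce_le hm hα (ε n) hδ ?_).trans
      (forceBound_le_forceBound_one hm hn1 hδ i j)
    by_cases hij : i = j
    · exact Or.inl hij
    · exact Or.inr (hn t ht i j hij)
  · exact (tendsto_finsetSum _ fun j _ => tendsto_perturbedForce m α hε0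
      (hpq.tendsto_at (hsub ht)) (eq_or_ne_of_not_isCollision (hnc t ht) i j)).const_smul _
  · exact (continuousOn_finsetSum _ fun j _ => continuousOn_pairForce m α hqc
      fun t ht => eq_or_ne_of_not_isCollision (hnc t ht) i j).const_smul (m i)⁻¹
  · exact tendsto_pi_nhds.1 (hpq.tendsto_at (hsub ht)) i

lemma contDiffOn_two_of_hasDerivWithinAt {E : Type*} [NormedAddCommGroup E] [NormedSpace ℝ E]
    {a b : ℝ} (hab : a < b) {f f' f'' : ℝ → E}
    (h1 : ∀ t ∈ Icc a b, HasDerivWithinAt f (f' t) (Icc a b) t)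
    (h2 : ∀ t ∈ Icc a b, HasDerivWithinAt f' (f'' t) (Icc a b) t)
    (h3 : ContinuousOn f'' (Icc a b)) : ContDiffOn ℝ 2 f (Icc a b) := by
  have hu := uniqueDiffOn_Icc hab
  have e1 : EqOn (derivWithin f (Icc a b)) f' (Icc a b) := fun t ht => (h1 t ht).derivWithin (hu t ht)
  have e2 : EqOn (derivWithin f' (Icc a b)) f'' (Icc a b) :=
    fun t ht => (h2 t ht).derivWithin (hu t ht)
  have c1 : ContDiffOn ℝ (0 + 1) f' (Icc a b) :=
    (contDiffOn_succ_iff_derivWithin hu).2 ⟨fun t ht => (h2 t ht).differentiableWithinAt, by simp,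
      contDiffOn_zero.2 (h3.congr e2)⟩
  have c2 : ContDiffOn ℝ (1 + 1) f (Icc a b) :=
    (contDiffOn_succ_iff_derivWithin hu).2 ⟨fun t ht => (h1 t ht).differentiableWithinAt, by simp,
      (by simpa using c1 : ContDiffOn ℝ 1 f' (Icc a b)).congr e1⟩
  simpa only [one_add_one_eq_two] using c2

lemma iteratedDerivWithin_two_of_hasDerivWithinAt {E : Type*} [NormedAddCommGroup E]
    [NormedSpace ℝ E] {a b : ℝ} (hab : a < b) {f f' : ℝ → E} {f'' : E}
    (h1 : ∀ t ∈ Icc a b, HasDerivWithinAt f (f' t) (Icc a b) t) {t₀ : ℝ} (ht₀ : t₀ ∈ Icc a b)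
    (h2 : HasDerivWithinAt f' f'' (Icc a b) t₀) :
    iteratedDerivWithin 2 f (Icc a b) t₀ = f'' := by
  have hu := uniqueDiffOn_Icc hab
  have e1 : EqOn (iteratedDerivWithin 1 f (Icc a b)) f' (Icc a b) := fun t ht => by
    rw [iteratedDerivWithin_one]
    exact (h1 t ht).derivWithin (hu t ht)
  rw [iteratedDerivWithin_succ]
  exact (h2.congr e1 (e1 ht₀)).derivWithin (hu t₀ ht₀)

section Sequence

variable (hT : T₁ < T₂) {m : Fin N → ℝ} (hm : ∀ i, 0 < m i) {α : ℝ}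
    (hα : 0 < α) {ε : ℕ → ℝ} (hε : ∀ n, 0 < ε n) (hε0 : Tendsto ε atTop (𝓝 0))
    {p : ℕ → ℝ → Config N d} (hp : ∀ n, IsCriticalPoint m α (ε n) T₁ T₂ (p n))
    {q : ℝ → Config N d} (hq : IsH1 T₁ T₂ q) (hpq : TendstoUniformlyOn p q atTop (Icc T₁ T₂))
    {t₀ : ℝ} (ht₀ : t₀ ∈ Icc T₁ T₂ \ collisionTimes T₁ T₂ q)

include hT hm hα hε hε0 hp hq hpq ht₀

lemma tendsto_velocity_of_not_collision (i : Fin N) :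
    Tendsto (fun n => velocity T₁ T₂ (p n) t₀ i) atTop (𝓝 (velocity T₁ T₂ q t₀ i)) := by
  obtain ⟨a, b, hab, htI, hsub, hnhds, hnc, h⟩ :=
    exists_local_solution hT hm hα hε hε0 hp hq hpq ht₀
  obtain ⟨u, hu⟩ := h i
  obtain ⟨h1, h2, h3⟩ := hu t₀ htI
  rwa [velocity_eq_of_hasDerivWithinAt hT ht₀.1 (h2.mono_of_mem_nhdsWithin hnhds)]

lemma contDiffWithinAt_of_not_collision : ContDiffWithinAt ℝ 2 q (Icc T₁ T₂) t₀ := by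
  obtain ⟨a, b, hab, htI, hsub, hnhds, hnc, h⟩ :=
    exists_local_solution hT hm hα hε hε0 hp hq hpq ht₀
  refine contDiffWithinAt_pi.2 fun i => ?_
  obtain ⟨u, hu⟩ := h i
  have hc : ContinuousOn (fun t => (m i)⁻¹ • ∑ j, pairForce m α (q t) i j) (Icc a b) :=
    (continuousOn_finsetSum _ fun j _ => continuousOn_pairForce m α (hq.continuousOn.mono hsub)
      fun t ht => eq_or_ne_of_not_isCollision (hnc t ht) i j).const_smul (m i)⁻¹
  exact (contDiffOn_two_of_hasDerivWithinAt hab (fun t ht => (hu t ht).2.1)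
    (fun t ht => (hu t ht).2.2) hc t₀ htI).mono_of_mem_nhdsWithin hnhds

lemma equation_of_not_collision (i : Fin N) :
    m i • iteratedDerivWithin 2 (fun s => q s i) (Icc T₁ T₂) t₀
      = ∑ j, pairForce m α (q t₀) i j := by
  obtain ⟨a, b, hab, htI, hsub, hnhds, hnc, h⟩ :=
    exists_local_solution hT hm hα hε hε0 hp hq hpq ht₀
  obtain ⟨u, hu⟩ := h i
  -- Iterated derivatives within a set depend only on its germ at `t₀`, so the local interval may
  -- replace the whole one.
  have hset : Icc T₁ T₂ =ᶠ[𝓝 t₀] Icc a b := by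
    filter_upwards [mem_nhdsWithin_iff_eventually.1 hnhds] with t ht
    exact propext ⟨ht, fun h => hsub h⟩
  rw [iteratedDerivWithin, iteratedFDerivWithin_congr_set hset, ← iteratedDerivWithin,
    iteratedDerivWithin_two_of_hasDerivWithinAt hab
    (fun t ht => (hu t ht).2.1) htI (hu t₀ htI).2.2, smul_smul, mul_inv_cancel₀ (hm i).ne',
    one_smul]

end Sequence

end Limit

/-! ### The energy balance of clusters and its passage to the limit. -/

section Energy

/-- On a finite measure space, a sequence which is bounded in `L²` and converges almost everywhere
converges in `L¹`. -/
lemma tendsto_integral_abs_sub_of_bounded_sq {μ : Measure ℝ} [IsFiniteMeasure μ]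
    {g : ℕ → ℝ → ℝ} {g₀ : ℝ → ℝ} {C : ℝ} (hg : ∀ n, MemLp (g n) 2 μ) (hg₀ : MemLp g₀ 2 μ)
    (hC : ∀ᶠ n in atTop, ∫ t, g n t ^ 2 ∂μ ≤ C)
    (hlim : ∀ᵐ t ∂μ, Tendsto (fun n => g n t) atTop (𝓝 (g₀ t))) :
    Tendsto (fun n => ∫ t, |g n t - g₀ t| ∂μ) atTop (𝓝 0) := by
  set D : ℝ := 2 * C + 2 * ∫ t, g₀ t ^ 2 ∂μ with hD
  have hd : ∀ n, MemLp (fun t => g n t - g₀ t) 2 μ := fun n => (hg n).sub hg₀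
  have hdsq : ∀ n, Integrable (fun t => (g n t - g₀ t) ^ 2) μ := fun n => (hd n).integrable_sq
  have hbound : ∀ᶠ n in atTop, ∫ t, (g n t - g₀ t) ^ 2 ∂μ ≤ D := by
    filter_upwards [hC] with n hn
    calc ∫ t, (g n t - g₀ t) ^ 2 ∂μ ≤ ∫ t, (2 * g n t ^ 2 + 2 * g₀ t ^ 2) ∂μ := by
          refine integral_mono (hdsq n) (((hg n).integrable_sq.const_mul 2).add
            (hg₀.integrable_sq.const_mul 2)) fun t => ?_
          simp only
          nlinarith [sq_nonneg (g n t + g₀ t)]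
      _ = 2 * ∫ t, g n t ^ 2 ∂μ + 2 * ∫ t, g₀ t ^ 2 ∂μ := by
          rw [integral_add ((hg n).integrable_sq.const_mul 2) (hg₀.integrable_sq.const_mul 2),
            integral_const_mul, integral_const_mul]
      _ ≤ D := by rw [hD]; linarith
  have htrunc : ∀ R : ℝ, 0 < R →
      Tendsto (fun n => ∫ t, min |g n t - g₀ t| R ∂μ) atTop (𝓝 0) := by
    intro R hR
    have h0 : ∫ _, (0 : ℝ) ∂μ = 0 := integral_zero _ _
    rw [← h0]
    refine tendsto_integral_of_dominated_convergence (fun _ => R) (fun n => ?_)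
      (integrable_const R) (fun n => Eventually.of_forall fun t => ?_) ?_
    · exact (hd n).1.norm.inf aestronglyMeasurable_const
    · rw [Real.norm_of_nonneg (le_min (abs_nonneg _) hR.le)]
      exact min_le_right _ _
    · filter_upwards [hlim] with t ht
      have h1 : Tendsto (fun n => |g n t - g₀ t|) atTop (𝓝 0) := by
        simpa using (ht.sub_const (g₀ t)).abs
      simpa [hR.le] using h1.min (tendsto_const_nhds (x := R))
  rw [Metric.tendsto_atTop']
  intro η hη
  -- From `|x| ≤ min |x| R + x ^ 2 / R`: the truncated part tends to zero by dominated convergence,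
  -- and `R` makes the tail at most `η / 2`.
  set R : ℝ := 2 * (|D| + 1) / η with hR
  have hR0 : 0 < R := by positivity
  have hev : ∀ᶠ n in atTop, dist (∫ t, |g n t - g₀ t| ∂μ) 0 < η := by
    filter_upwards [hbound, (htrunc R hR0).eventually (gt_mem_nhds (half_pos hη))] with n h1 h2
    rw [Real.dist_0_eq_abs, abs_of_nonneg (integral_nonneg fun t => abs_nonneg _)]
    have hmin : Integrable (fun t => min |g n t - g₀ t| R) μ :=
      ((hd n).integrable (by norm_num)).abs.inf (integrable_const R)
    calc ∫ t, |g n t - g₀ t| ∂μ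
        ≤ ∫ t, (min |g n t - g₀ t| R + R⁻¹ * (g n t - g₀ t) ^ 2) ∂μ := by
          refine integral_mono ((hd n).integrable (by norm_num)).abs
            (hmin.add ((hdsq n).const_mul _)) fun t => ?_
          simp only
          rcases le_total |g n t - g₀ t| R with h | h
          · rw [min_eq_left h]
            have : 0 ≤ R⁻¹ * (g n t - g₀ t) ^ 2 := by positivity
            linarith
          · rw [min_eq_right h, ← sq_abs (g n t - g₀ t)]
            have h3 : |g n t - g₀ t| ≤ R⁻¹ * |g n t - g₀ t| ^ 2 := by
              rw [inv_mul_eq_div, le_div_iff₀ hR0, sq]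
              exact mul_le_mul_of_nonneg_left h (abs_nonneg _)
            linarith
      _ = ∫ t, min |g n t - g₀ t| R ∂μ + R⁻¹ * ∫ t, (g n t - g₀ t) ^ 2 ∂μ := by
          rw [integral_add hmin ((hdsq n).const_mul _), integral_const_mul]
      _ < η / 2 + R⁻¹ * (|D| + 1) := by
          have h4 : R⁻¹ * ∫ t, (g n t - g₀ t) ^ 2 ∂μ ≤ R⁻¹ * (|D| + 1) := by
            gcongr
            linarith [le_abs_self D]
          linarith
      _ = η := by
          rw [hR]
          field_simp
          ring
  obtain ⟨n₀, hn₀⟩ := eventually_atTop.1 hev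
  exact ⟨n₀, fun n hn => hn₀ n hn.le⟩

lemma tendsto_intervalIntegral_of_bounded_sq {a b C : ℝ} {g : ℕ → ℝ → ℝ} {g₀ : ℝ → ℝ}
    (hg : ∀ n, MemLp (g n) 2 (volume.restrict (Icc a b)))
    (hg₀ : MemLp g₀ 2 (volume.restrict (Icc a b)))
    (hC : ∀ᶠ n in atTop, ∫ t in Icc a b, g n t ^ 2 ≤ C)
    (hlim : ∀ᵐ t ∂volume.restrict (Icc a b), Tendsto (fun n => g n t) atTop (𝓝 (g₀ t)))
    {s t : ℝ} (hs : s ∈ Icc a b) (ht : t ∈ Icc a b) :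
    Tendsto (fun n => ∫ τ in s..t, g n τ) atTop (𝓝 (∫ τ in s..t, g₀ τ)) := by
  rw [tendsto_iff_norm_sub_tendsto_zero]
  refine squeeze_zero (fun n => norm_nonneg _) (fun n => ?_)
    (tendsto_integral_abs_sub_of_bounded_sq hg hg₀ hC hlim)
  rw [← intervalIntegral.integral_sub (intervalIntegrable_of_memLp_two (hg n) hs ht)
    (intervalIntegrable_of_memLp_two hg₀ hs ht)]
  refine intervalIntegral.norm_integral_le_integral_norm_uIoc.trans ?_
  refine setIntegral_mono_set ?_ (Eventually.of_forall fun t => norm_nonneg _)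
    (uIoc_subset_uIcc.trans (uIcc_subset_Icc hs ht)).eventuallyLE
  exact (((hg n).sub hg₀).integrable (by norm_num)).norm

variable {N d : ℕ} {T₁ T₂ : ℝ}

/-- The integrand of the action is `+∞` at each collision moment, so a set of positive measure would
make the action infinite. -/
lemma measure_collisionTimes {m : Fin N → ℝ} {α : ℝ} {q : ℝ → Config N d}
    (hq : IsH1 T₁ T₂ q) (hfin : action m α 0 T₁ T₂ q < ⊤) :
    volume (collisionTimes T₁ T₂ q) = 0 := by
  have hmeas : MeasurableSet (collisionTimes T₁ T₂ q) := by
    have : collisionTimes T₁ T₂ q = Icc T₁ T₂ ∩ q ⁻¹' {x | IsCollision x} := rfl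
    rw [this]
    refine (hq.continuousOn.preimage_isClosed_of_isClosed isClosed_Icc ?_).measurableSet
    exact ⟨isOpen_not_isCollision⟩
  by_contra h
  refine hfin.ne (top_unique ?_)
  calc (⊤ : ℝ≥0∞) = ∫⁻ _ in collisionTimes T₁ T₂ q, ⊤ := by
        rw [setLIntegral_const, ENNReal.top_mul h]
    _ ≤ ∫⁻ t in collisionTimes T₁ T₂ q,
        (ENNReal.ofReal (kinetic m Finset.univ (velocity T₁ T₂ q t)) + extPotential m α (q t)
          + ENNReal.ofReal 0 * extPotential m 2 (q t)) := by
        refine setLIntegral_mono' hmeas fun t ht => ?_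
        simp [extPotential, ht.2]
    _ ≤ action m α 0 T₁ T₂ q := lintegral_mono_set fun t ht => ht.1

/-- The action bounds the `L²` norms of the velocities. -/
lemma integral_norm_velocity_sq_le (hT : T₁ < T₂) {m : Fin N → ℝ} (hm : ∀ i, 0 < m i) {α ε : ℝ}
    (hε : 0 ≤ ε) {p : ℝ → Config N d} (hp : IsH1 T₁ T₂ p)
    (hc : ∀ t ∈ Icc T₁ T₂, ¬ IsCollision (p t)) {C : ℝ}
    (hC : action m α ε T₁ T₂ p < ENNReal.ofReal C) (i : Fin N) :
    ∫ t in Icc T₁ T₂, ‖velocity T₁ T₂ p t i‖ ^ 2 ≤ 2 / m i * C := by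
  have h1 : ∫ t in Icc T₁ T₂, lagrangian m α ε (p t) (velocity T₁ T₂ p t) ≤ C := by
    rw [← toReal_action hT hm α hε hp hc]
    exact (ENNReal.toReal_lt_of_lt_ofReal hC).le
  have hv := (memLp_two_apply (hp.memLp_velocity hT) i).integrable_norm_pow (p := 2) (by norm_num)
  have h2 : ∫ t in Icc T₁ T₂, m i / 2 * ‖velocity T₁ T₂ p t i‖ ^ 2
      ≤ ∫ t in Icc T₁ T₂, lagrangian m α ε (p t) (velocity T₁ T₂ p t) := by
    refine integral_mono (hv.const_mul _) (integrable_lagrangian hT m α ε hp hc) fun t => ?_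
    have h3 : m i * ‖velocity T₁ T₂ p t i‖ ^ 2 ≤ ∑ k, m k * ‖velocity T₁ T₂ p t k‖ ^ 2 :=
      Finset.single_le_sum (f := fun k => m k * ‖velocity T₁ T₂ p t k‖ ^ 2)
        (fun k _ => mul_nonneg (hm k).le (by positivity)) (Finset.mem_univ i)
    have h4 := potential_nonneg hm α Finset.univ (p t)
    have h5 := mul_nonneg hε (potential_nonneg hm 2 Finset.univ (p t))
    simp only [lagrangian, kinetic, perturbedPotential]
    linarith
  rw [integral_const_mul] at h2
  have := hm i
  rw [div_mul_eq_mul_div, le_div_iff₀ this]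
  linarith

/-- The power of the forces exerted on the cluster `I` by the outside masses. -/
noncomputable def outsidePower (m : Fin N → ℝ) (α ε : ℝ) (I : Finset (Fin N)) (x v : Config N d) :
    ℝ :=
  ∑ i ∈ I, ∑ j ∈ Iᶜ, inner ℝ (perturbedForce m α ε x i j) (v i)

/-- The rate of change of the energy of a cluster along a solution of the perturbed problem. -/
lemma IsCriticalPoint.hasDerivWithinAt_energy (hT : T₁ < T₂) {m : Fin N → ℝ} (hm : ∀ i, 0 < m i)
    {α : ℝ} (hα : 0 < α) {ε : ℝ} (hε : 0 ≤ ε) {p : ℝ → Config N d}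
    (hp : IsCriticalPoint m α ε T₁ T₂ p) (I : Finset (Fin N)) {t : ℝ} (ht : t ∈ Icc T₁ T₂) :
    HasDerivWithinAt (fun s => kinetic m I (velocity T₁ T₂ p s) - perturbedPotential m α ε I (p s))
      (outsidePower m α ε I (p t) (velocity T₁ T₂ p t)) (Icc T₁ T₂) t := by
  have hk : HasDerivWithinAt (fun s => kinetic m I (velocity T₁ T₂ p s))
      (∑ i ∈ I, ∑ j, inner ℝ (perturbedForce m α ε (p t) i j) (velocity T₁ T₂ p t i))
      (Icc T₁ T₂) t := by
    unfold kinetic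
    refine ((HasDerivWithinAt.fun_sum fun i (_ : i ∈ I) =>
      ((hp.hasDerivWithinAt hT hm hα hε ht i).2.norm_sq).const_mul (m i)).const_mul
        (1 / 2)).congr_deriv ?_
    rw [Finset.mul_sum]
    refine Finset.sum_congr rfl fun i _ => ?_
    rw [real_inner_smul_right, inner_sum]
    have h0 := (hm i).ne'
    simp only [real_inner_comm (velocity T₁ T₂ p t i)]
    field_simp
  refine (hk.sub (hasDerivWithinAt_perturbedPotential m α ε I
    (fun i => (hp.hasDerivWithinAt hT hm hα hε ht i).1) (hp.2.1 t ht))).congr_deriv ?_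
  rw [outsidePower, ← Finset.sum_sub_distrib]
  refine Finset.sum_congr rfl fun i _ => ?_
  -- The work of the internal forces is exactly the change of the internal potential; only the
  -- outside masses remain.
  rw [← Finset.sum_add_sum_compl I, add_sub_cancel_left]

lemma IsCriticalPoint.continuousOn_velocity (hT : T₁ < T₂) {m : Fin N → ℝ} (hm : ∀ i, 0 < m i)
    {α : ℝ} (hα : 0 < α) {ε : ℝ} (hε : 0 ≤ ε) {p : ℝ → Config N d}
    (hp : IsCriticalPoint m α ε T₁ T₂ p) (i : Fin N) :
    ContinuousOn (fun t => velocity T₁ T₂ p t i) (Icc T₁ T₂) := fun _ ht =>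
  (hp.hasDerivWithinAt hT hm hα hε ht i).2.continuousWithinAt

lemma memLp_inner_pairForce {m : Fin N → ℝ} {α : ℝ} {t₁ t₂ : ℝ} {q v : ℝ → Config N d}
    (hq : ContinuousOn q (Icc t₁ t₂)) (hv : MemLp v 2 (volume.restrict (Icc t₁ t₂))) {i j : Fin N}
    (h : ∀ t ∈ Icc t₁ t₂, i = j ∨ q t i ≠ q t j) (ε : ℝ) :
    MemLp (fun t => inner ℝ (perturbedForce m α ε (q t) i j) (v t i)) 2
      (volume.restrict (Icc t₁ t₂)) := by
  have hf := continuousOn_perturbedForce m α ε hq h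
  obtain ⟨B, hB⟩ := isCompact_Icc.exists_bound_of_continuousOn hf
  have hvi := memLp_two_apply hv i
  refine hvi.of_le_mul (c := B) ((hf.aestronglyMeasurable measurableSet_Icc).inner hvi.1) ?_
  filter_upwards [ae_restrict_mem measurableSet_Icc] with t ht
  exact (norm_inner_le_norm _ _).trans (mul_le_mul_of_nonneg_right (hB t ht) (norm_nonneg _))

lemma memLp_outsidePower (m : Fin N → ℝ) (α ε : ℝ) {I : Finset (Fin N)} {t₁ t₂ : ℝ}
    {q v : ℝ → Config N d} (hq : ContinuousOn q (Icc t₁ t₂))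
    (hv : MemLp v 2 (volume.restrict (Icc t₁ t₂)))
    (h : ∀ t ∈ Icc t₁ t₂, NoOutsideCollision q I t) :
    MemLp (fun t => outsidePower m α ε I (q t) (v t)) 2 (volume.restrict (Icc t₁ t₂)) :=
  memLp_finsetSum _ fun i hi => memLp_finsetSum _ fun j hj => memLp_inner_pairForce hq hv
    (fun t ht => Or.inr (h t ht i hi j (Finset.mem_compl.1 hj))) ε

section Limit

variable (hT : T₁ < T₂) {m : Fin N → ℝ} (hm : ∀ i, 0 < m i) {α : ℝ}
    (hα : 0 < α) {ε : ℕ → ℝ} (hε : ∀ n, 0 < ε n) (hε0 : Tendsto ε atTop (𝓝 0))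
    {p : ℕ → ℝ → Config N d} (hp : ∀ n, IsCriticalPoint m α (ε n) T₁ T₂ (p n))
    {q : ℝ → Config N d} (hq : IsH1 T₁ T₂ q) (hpq : TendstoUniformlyOn p q atTop (Icc T₁ T₂))

include hT hm hα hε hε0 hp hq hpq

lemma tendsto_energy (I : Finset (Fin N)) {t : ℝ}
    (ht : t ∈ Icc T₁ T₂ \ collisionTimes T₁ T₂ q) :
    Tendsto (fun n => kinetic m I (velocity T₁ T₂ (p n) t)
      - perturbedPotential m α (ε n) I (p n t)) atTop (𝓝 (clusterEnergy m α T₁ T₂ q I t)) := by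
  have hc : ¬ IsCollision (q t) := fun h => ht.2 ⟨ht.1, h⟩
  have hx := hpq.tendsto_at ht.1
  refine Tendsto.sub ?_ ?_
  · exact (tendsto_finsetSum _ fun i _ => (((tendsto_velocity_of_not_collision hT hm hα hε hε0 hp
      hq hpq ht i).norm).pow 2).const_mul (m i)).const_mul (1 / 2)
  · have h1 := (continuousAt_potential m α I hc).tendsto.comp hx
    have h2 := hε0.mul ((continuousAt_potential m 2 I hc).tendsto.comp hx)
    simpa [perturbedPotential] using h1.add h2

/-- The energy balance of `p n` is passed to the limit. It holds between `s` and `t` even if masses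
inside `I` collide in between, since the power involves only forces across the boundary of the
cluster. -/
lemma clusterEnergy_sub (hfin : action m α 0 T₁ T₂ q < ⊤)
    (hbd : ∃ C : ℝ, ∀ n, action m α (ε n) T₁ T₂ (p n) < ENNReal.ofReal C)
    {I : Finset (Fin N)} {t₁ t₂ : ℝ} (h1 : T₁ ≤ t₁) (h2 : t₂ ≤ T₂)
    (h : ∀ t ∈ Icc t₁ t₂, NoOutsideCollision q I t) {s t : ℝ}
    (hs : s ∈ Icc t₁ t₂ \ collisionTimes T₁ T₂ q) (ht : t ∈ Icc t₁ t₂ \ collisionTimes T₁ T₂ q) :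
    clusterEnergy m α T₁ T₂ q I t - clusterEnergy m α T₁ T₂ q I s
      = ∫ τ in s..t, outsidePower m α 0 I (q τ) (velocity T₁ T₂ q τ) := by
  have hsub : Icc t₁ t₂ ⊆ Icc T₁ T₂ := Icc_subset_Icc h1 h2
  have hqc := hq.continuousOn.mono hsub
  have hmono : volume.restrict (Icc t₁ t₂) ≤ volume.restrict (Icc T₁ T₂) :=
    Measure.restrict_mono hsub le_rfl
  have hv := (hq.memLp_velocity hT).mono_measure hmono
  have hvn : ∀ n, MemLp (velocity T₁ T₂ (p n)) 2 (volume.restrict (Icc t₁ t₂)) := fun n =>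
    ((hp n).1.1.memLp_velocity hT).mono_measure hmono
  have hpc : ∀ n, ContinuousOn (p n) (Icc t₁ t₂) := fun n => (hp n).1.1.continuousOn.mono hsub
  have hpnc : ∀ n, ∀ t ∈ Icc t₁ t₂, ∀ i j, i = j ∨ p n t i ≠ p n t j := fun n t ht =>
    eq_or_ne_of_not_isCollision ((hp n).2.1 t (hsub ht))
  obtain ⟨C, hC⟩ := hbd
  obtain ⟨δ, hδ, hsep⟩ := exists_uniform_separation isCompact_Icc hqc (hpq.mono hsub)
    (fun i j => i ∈ I ∧ j ∉ I) (fun t ht i j hij => h t ht i hij.1 j hij.2)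
  have hnull : ∀ᵐ τ ∂volume.restrict (Icc t₁ t₂), τ ∈ Icc T₁ T₂ \ collisionTimes T₁ T₂ q := by
    have h0 : ∀ᵐ τ ∂volume, τ ∉ collisionTimes T₁ T₂ q :=
      measure_eq_zero_iff_ae_notMem.1 (measure_collisionTimes hq hfin)
    filter_upwards [ae_restrict_of_ae h0, ae_restrict_mem measurableSet_Icc] with τ hτ hτI
    exact ⟨hsub hτI, hτ⟩
  have hE : ∀ n, (kinetic m I (velocity T₁ T₂ (p n) t) - perturbedPotential m α (ε n) I (p n t))
      - (kinetic m I (velocity T₁ T₂ (p n) s) - perturbedPotential m α (ε n) I (p n s))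
      = ∫ τ in s..t, outsidePower m α (ε n) I (p n τ) (velocity T₁ T₂ (p n) τ) := fun n => by
    refine sub_eq_integral_of_hasDerivWithinAt
      (f := fun t => kinetic m I (velocity T₁ T₂ (p n) t)
        - perturbedPotential m α (ε n) I (p n t))
      (fun τ hτ => (hp n).hasDerivWithinAt_energy hT hm hα (hε n).le I hτ) ?_ (hsub hs.1)
      (hsub ht.1)
    exact continuousOn_finsetSum _ fun i _ => continuousOn_finsetSum _ fun j _ =>
      (continuousOn_perturbedForce m α (ε n) (hp n).1.1.continuousOn fun t ht =>
        eq_or_ne_of_not_isCollision ((hp n).2.1 t ht) i j).inner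
        ((hp n).continuousOn_velocity hT hm hα (hε n).le i)
  refine tendsto_nhds_unique ((tendsto_energy hT hm hα hε hε0 hp hq hpq I ⟨hsub ht.1, ht.2⟩).sub
    (tendsto_energy hT hm hα hε hε0 hp hq hpq I ⟨hsub hs.1, hs.2⟩)) ?_
  simp_rw [hE]
  have hterm : ∀ i ∈ I, ∀ j ∈ Iᶜ, Tendsto
      (fun n => ∫ τ in s..t, inner ℝ (perturbedForce m α (ε n) (p n τ) i j)
        (velocity T₁ T₂ (p n) τ i)) atTop
      (𝓝 (∫ τ in s..t, inner ℝ (perturbedForce m α 0 (q τ) i j) (velocity T₁ T₂ q τ i))) := by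
    intro i hi j hj
    have hne : ∀ t ∈ Icc t₁ t₂, i = j ∨ q t i ≠ q t j := fun t ht =>
      Or.inr (h t ht i hi j (Finset.mem_compl.1 hj))
    -- The constant is the squared bound of the outside force, uniform for `|ε n| ≤ 1`, times the
    -- `L²` bound of the velocity that comes from the action.
    refine tendsto_intervalIntegral_of_bounded_sq
      (C := forceBound m α 1 δ i j ^ 2 * (2 / m i * C))
      (fun n => memLp_inner_pairForce (hpc n) (hvn n) (fun t ht => hpnc n t ht i j) (ε n))
      (memLp_inner_pairForce hqc hv hne 0) ?_ ?_ hs.1 ht.1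
    · filter_upwards [hsep, eventually_abs_le_one hε0] with n hn hn1
      have hvsq := (memLp_two_apply ((hp n).1.1.memLp_velocity hT) i).integrable_norm_pow
        (p := 2) (by norm_num)
      calc ∫ τ in Icc t₁ t₂, inner ℝ (perturbedForce m α (ε n) (p n τ) i j)
            (velocity T₁ T₂ (p n) τ i) ^ 2
          ≤ ∫ τ in Icc t₁ t₂, forceBound m α 1 δ i j ^ 2 * ‖velocity T₁ T₂ (p n) τ i‖ ^ 2 := by
            refine setIntegral_mono_on ?_ ((hvsq.mono_measure hmono).const_mul _)
              measurableSet_Icc fun τ hτ => ?_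
            · exact (memLp_inner_pairForce (hpc n) (hvn n)
                (fun t ht => hpnc n t ht i j) (ε n)).integrable_sq
            · rw [← sq_abs, ← mul_pow]
              refine pow_le_pow_left₀ (abs_nonneg _) ((abs_real_inner_le_norm _ _).trans
                (mul_le_mul_of_nonneg_right ?_ (norm_nonneg _))) 2
              exact (norm_perturbedForce_le hm hα (ε n) hδ
                (Or.inr (hn τ hτ i j ⟨hi, Finset.mem_compl.1 hj⟩))).trans
                (forceBound_le_forceBound_one hm hn1 hδ i j)
        _ = forceBound m α 1 δ i j ^ 2 * ∫ τ in Icc t₁ t₂, ‖velocity T₁ T₂ (p n) τ i‖ ^ 2 :=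
            integral_const_mul _ _
        _ ≤ forceBound m α 1 δ i j ^ 2 * (2 / m i * C) := by
            refine mul_le_mul_of_nonneg_left ?_ (sq_nonneg _)
            refine le_trans ?_ (integral_norm_velocity_sq_le hT hm (hε n).le (hp n).1.1
              (hp n).2.1 (hC n) i)
            exact setIntegral_mono_set hvsq (Eventually.of_forall fun τ => sq_nonneg _)
              hsub.eventuallyLE
    · filter_upwards [hnull, ae_restrict_mem measurableSet_Icc] with τ hτ hτI
      rw [perturbedForce_zero]
      exact (tendsto_perturbedForce m α hε0 (hpq.tendsto_at hτ.1) (hne τ hτI)).inner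
        (tendsto_velocity_of_not_collision hT hm hα hε hε0 hp hq hpq hτ i)
  -- Stated for a general path because it is applied both to `q` with `ε' = 0` and to each `p n`
  -- with `ε' = ε n`.
  have hsplit : ∀ (ε' : ℝ) (x v : ℝ → Config N d), ContinuousOn x (Icc t₁ t₂) →
      MemLp v 2 (volume.restrict (Icc t₁ t₂)) →
      (∀ t ∈ Icc t₁ t₂, NoOutsideCollision x I t) →
      ∫ τ in s..t, outsidePower m α ε' I (x τ) (v τ)
        = ∑ i ∈ I, ∑ j ∈ Iᶜ, ∫ τ in s..t, inner ℝ (perturbedForce m α ε' (x τ) i j) (v τ i) := by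
    intro ε' x v hx hv' hxI
    have hi : ∀ i ∈ I, ∀ j ∈ Iᶜ, IntervalIntegrable
        (fun τ => inner ℝ (perturbedForce m α ε' (x τ) i j) (v τ i)) volume s t :=
      fun i hi j hj => intervalIntegrable_of_memLp_two (memLp_inner_pairForce hx hv'
        (fun t ht => Or.inr (hxI t ht i hi j (Finset.mem_compl.1 hj))) ε') hs.1 ht.1
    have hi' : ∀ i ∈ I, IntervalIntegrable
        (fun τ => ∑ j ∈ Iᶜ, inner ℝ (perturbedForce m α ε' (x τ) i j) (v τ i)) volume s t :=
      fun i hiI => by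
        have h' := IntervalIntegrable.sum _ fun j hj => hi i hiI j hj
        rwa [Finset.sum_fn] at h'
    simp only [outsidePower]
    rw [intervalIntegral.integral_finsetSum hi']
    exact Finset.sum_congr rfl fun i hiI =>
      intervalIntegral.integral_finsetSum fun j hj => hi i hiI j hj
  rw [hsplit 0 q _ hqc hv h]
  refine (tendsto_finsetSum _ fun i hi => tendsto_finsetSum _ fun j hj =>
    hterm i hi j hj).congr fun n => (hsplit (ε n) (p n) _ (hpc n) (hvn n) ?_).symm
  intro t ht i hi j hj
  exact (hpnc n t ht i j).resolve_left fun e => hj (e ▸ hi)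

end Limit

end Energy

/-! ### Assembling the generalized solution. -/

section GeneralizedSolution

variable {N d : ℕ} {T₁ T₂ : ℝ}

lemma exists_not_collision_mem_Ioo {q : ℝ → Config N d}
    (h0 : volume (collisionTimes T₁ T₂ q) = 0) {t₁ t₂ : ℝ} (h : t₁ < t₂) :
    ∃ s ∈ Ioo t₁ t₂, s ∉ collisionTimes T₁ T₂ q := by
  by_contra! hsub
  have h1 : volume (Ioo t₁ t₂) = 0 := measure_mono_null hsub h0
  rw [Real.volume_Ioo, ENNReal.ofReal_eq_zero] at h1
  linarith

/-- The base point `c` may lie outside `[a, b]`, so that one primitive can serve all compact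
subintervals of an open interval. -/
lemma isH1_integral {a b c e₀ : ℝ} {P : ℝ → ℝ} {l r : ℝ}
    (hP : MemLp P 2 (volume.restrict (Icc l r))) (ha : a ∈ Icc l r)
    (hb : b ∈ Icc l r) (hc : c ∈ Icc l r) : IsH1 a b (fun t => e₀ + ∫ τ in c..t, P τ) := by
  refine ⟨P, hP.mono_measure (Measure.restrict_mono (Icc_subset_Icc ha.1 hb.2) le_rfl),
    fun t ht => ?_⟩
  have htI : t ∈ Icc l r := ⟨ha.1.trans ht.1, ht.2.trans hb.2⟩
  rw [add_assoc, intervalIntegral.integral_add_adjacent_intervals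
    (intervalIntegrable_of_memLp_two hP hc ha) (intervalIntegrable_of_memLp_two hP ha htI)]

lemma sum_pairForce (m : Fin N → ℝ) (α : ℝ) (x : Config N d) (i : Fin N) :
    ∑ j, pairForce m α x i j = -α • ∑ j ∈ Finset.univ.erase i,
      (m i * m j / ‖x i - x j‖ ^ (α + 2)) • (x i - x j) := by
  rw [Finset.smul_sum, ← Finset.sum_erase Finset.univ (pairForce_self m α x i)]
  exact Finset.sum_congr rfl fun j _ => mul_smul _ _ _

/-- Weak critical points of the action are generalized solutions. -/
theorem IsWeakCriticalPoint.isGeneralizedSolution {m : Fin N → ℝ} (hm : ∀ i, 0 < m i) {α : ℝ}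
    (hα : 0 < α) (hT : T₁ < T₂) {q : ℝ → Config N d} (hq : IsWeakCriticalPoint m α T₁ T₂ q) :
    IsGeneralizedSolution m α T₁ T₂ q := by
  obtain ⟨hcen, hfin, ε, p, hε, hε0, -, hbd, hp, -, hpq⟩ := hq
  have hH := hcen.1
  have h0 := measure_collisionTimes hH hfin
  have hsub : ∀ {I : Finset (Fin N)} {t₁ t₂ : ℝ}, T₁ ≤ t₁ → t₂ ≤ T₂ →
      (∀ t ∈ Icc t₁ t₂, NoOutsideCollision q I t) → ∀ {s t : ℝ},
      s ∈ Icc t₁ t₂ \ collisionTimes T₁ T₂ q → t ∈ Icc t₁ t₂ \ collisionTimes T₁ T₂ q →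
      clusterEnergy m α T₁ T₂ q I t = clusterEnergy m α T₁ T₂ q I s
        + ∫ τ in s..t, outsidePower m α 0 I (q τ) (velocity T₁ T₂ q τ) :=
    fun h1 h2 h s t hs ht => by
      rw [← clusterEnergy_sub hT hm hα hε hε0 hp hH hpq hfin hbd h1 h2 h hs ht, add_sub_cancel]
  have hmem : ∀ {I : Finset (Fin N)} {t₁ t₂ : ℝ}, T₁ ≤ t₁ → t₂ ≤ T₂ →
      (∀ t ∈ Icc t₁ t₂, NoOutsideCollision q I t) →
      MemLp (fun τ => outsidePower m α 0 I (q τ) (velocity T₁ T₂ q τ)) 2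
        (volume.restrict (Icc t₁ t₂)) := fun h1 h2 h =>
    memLp_outsidePower m α 0 (hH.continuousOn.mono (Icc_subset_Icc h1 h2))
      ((hH.memLp_velocity hT).mono_measure (Measure.restrict_mono (Icc_subset_Icc h1 h2) le_rfl)) h
  refine ⟨hcen, h0, fun t ht => ?_, fun t ht i => ?_, ?_, ?_, ?_⟩
  · exact (contDiffWithinAt_of_not_collision hT hm hα hε hε0 hp hH hpq ht).mono sdiff_subset
  · rw [equation_of_not_collision hT hm hα hε hε0 hp hH hpq ht i, sum_pairForce]
  · obtain ⟨s, hs, hsc⟩ := exists_not_collision_mem_Ioo h0 hT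
    refine ⟨clusterEnergy m α T₁ T₂ q Finset.univ s, fun t ht => ?_⟩
    rw [hsub le_rfl le_rfl (fun _ _ i _ j hj => absurd (Finset.mem_univ j) hj)
      ⟨Ioo_subset_Icc_self hs, hsc⟩ ht]
    -- The complement of the full cluster is empty, so the power vanishes.
    simp [outsidePower]
  · intro I t₁ t₂ h1 h12 h2 h
    obtain ⟨s, hs, hsc⟩ := exists_not_collision_mem_Ioo h0 h12
    have hsI := Ioo_subset_Icc_self hs
    exact ⟨fun t => clusterEnergy m α T₁ T₂ q I s
      + ∫ τ in s..t, outsidePower m α 0 I (q τ) (velocity T₁ T₂ q τ),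
      isH1_integral (hmem h1 h2 h) (left_mem_Icc.2 h12.le) (right_mem_Icc.2 h12.le) hsI,
      fun t ht => hsub h1 h2 h ⟨hsI, hsc⟩ ht⟩
  · intro I t₁ t₂ h1 h12 h2 h
    obtain ⟨s, hs, hsc⟩ := exists_not_collision_mem_Ioo h0 h12
    have hIcc : ∀ {l r : ℝ}, t₁ < l → r < t₂ → ∀ t ∈ Icc l r, NoOutsideCollision q I t :=
      fun hl hr t ht => h t ⟨hl.trans_le ht.1, ht.2.trans_lt hr⟩
    have hH1 : ∀ a b : ℝ, t₁ < a → a < b → b < t₂ →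
        IsH1 a b fun t => clusterEnergy m α T₁ T₂ q I s
          + ∫ τ in s..t, outsidePower m α 0 I (q τ) (velocity T₁ T₂ q τ) := by
      intro a b ha hab hb
      -- The interval is enlarged to contain the fixed moment `s`, while staying compactly inside
      -- `(t₁, t₂)`, where `I` is separated from the other masses.
      have hl : t₁ < min a s := lt_min ha hs.1
      have hr : max b s < t₂ := max_lt hb hs.2
      exact isH1_integral (hmem (h1.trans hl.le) (hr.le.trans h2) (hIcc hl hr))
        ⟨min_le_left _ _, hab.le.trans (le_max_left _ _)⟩
        ⟨(min_le_left _ _).trans hab.le, le_max_left _ _⟩ ⟨min_le_right _ _, le_max_right _ _⟩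
    refine ⟨_, fun t ht => ?_, hH1, fun t ht => ?_⟩
    · obtain ⟨a, ha, hat⟩ := exists_between ht.1
      obtain ⟨b, htb, hb⟩ := exists_between ht.2
      exact ((hH1 a b ha (hat.trans htb) hb).continuousOn.continuousAt
        (Icc_mem_nhds hat htb)).continuousWithinAt
    · have hl : t₁ < min t s := lt_min ht.1.1 hs.1
      have hr : max t s < t₂ := max_lt ht.1.2 hs.2
      exact hsub (h1.trans hl.le) (hr.le.trans h2) (hIcc hl hr)
        ⟨⟨min_le_right _ _, le_max_right _ _⟩, hsc⟩ ⟨⟨min_le_left _ _, le_max_left _ _⟩, ht.2⟩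

end GeneralizedSolution

end NBody

theorem mainTheorem6 (N d : ℕ) (m : Fin N → ℝ) (hm : ∀ i, 0 < m i)
    (α : ℝ) (hα₀ : 0 < α) (hα₂ : α < 2) (T₁ T₂ : ℝ) (hT : T₁ < T₂)
    (q : ℝ → NBody.Config N d) (hq : NBody.IsWeakCriticalPoint m α T₁ T₂ q) :
    NBody.IsGeneralizedSolution m α T₁ T₂ q := by
  exact hq.isGeneralizedSolution hm hα₀ hT
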